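/- For a graph $G$ with distance $d_G$ and an integer $c\ge 1$, a \emph{packing $c$-coloring} of $G$ is a map $f$ from $V(G)$ onto $\{1,\dots,c\}$ such that any two distinct vertices $u,v$ with $f(u)=f(v)=i$ satisfy $d_G(u,v)>i$. The \emph{packing chromatic number} $\chi_\rho(G)$ is the smallest $c$ for which $G$ has a packing $c$-coloring. The base-3 Sierpiński graphs $S^n$ are defined by $S^0=K_1$ and, for $n\ge 1$, $V(S^n)=\{0,1,2\}^n$ and $$E(S^n)=\{\{is,it\} : i\in\{0,1,2\},\ \{s,t\}\in E(S^{n-1})\}\cup\{\{ij^{n-1},ji^{n-1}\} : i,j\in\{0,1,2\},\ i\ne j\}.$$ For $n\ge 0$, the Sierpiński triangle graph $ST_3^n$ is the simple graph obtained from $S^{n+1}$ by contracting all non-clique edges, i.e. all edges that lie in no triangle. \textbf{Theorem.} (i) $\chi_\rho(ST_3^0)=3$, $\chi_\rho(ST_3^1)=4$, $\chi_\rho(ST_3^2)=8$ and $\chi_\rho(ST_3^3)=12$. (ii) $12\le\chi_\rho(ST_3^4)\le 15$. (iii) $12\le\chi_\rho(ST_3^5)\le 19$. (iv) For every $n\ge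 6$, $12\le\chi_\rho(ST_3^n)\le 20$. -/

import Mathlib

namespace SierpinskiPacking

/-- The base-3 Sierpiński graph `S^n` on the words of length `n` over a three-letter alphabet.
`S^0` is the one-vertex graph; two words of length `n + 1` are adjacent if either they have the
same first letter and their tails are adjacent in `S^n`, or they are `i j ⋯ j` and `j i ⋯ i` for
distinct letters `i`, `j`. -/
def sierpinskiGraph : (n : ℕ) → SimpleGraph (Fin n → Fin 3)
  | 0 => ⊥
  | n + 1 =>
    { Adj := fun u v =>
        (u 0 = v 0 ∧ (sierpinskiGraph n).Adj (Fin.tail u) (Fin.tail v)) ∨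
          (u 0 ≠ v 0 ∧ (∀ k, Fin.tail u k = v 0) ∧ (∀ k, Fin.tail v k = u 0))
      symm := ⟨fun _ _ h => h.elim
        (fun h => Or.inl ⟨h.1.symm, h.2.symm⟩)
        (fun h => Or.inr ⟨h.1.symm, h.2.2, h.2.1⟩)⟩
      loopless := ⟨fun _ h => h.elim (fun h => h.2.ne rfl) (fun h => h.1 rfl)⟩ }

/-- `uv` is a non-clique edge of `G`: an edge that lies in no triangle. -/
def IsNonCliqueEdge {V : Type*} (G : SimpleGraph V) (u v : V) : Prop :=
  G.Adj u v ∧ ∀ w, ¬ (G.Adj u w ∧ G.Adj v w)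

/-- The equivalence relation on `V` whose classes are merged into single vertices when all edges
`uv` with `r u v` are contracted. -/
def contractionSetoid {V : Type*} (r : V → V → Prop) : Setoid V := Relation.EqvGen.setoid r

/-- The simple graph obtained from `G` by contracting all pairs related by `r`: distinct classes
are adjacent if some representatives are adjacent in `G`. -/
def contract {V : Type*} (G : SimpleGraph V) (r : V → V → Prop) :
    SimpleGraph (Quotient (contractionSetoid r)) :=
  G.map (Quotient.mk (contractionSetoid r))

/-- The Sierpiński triangle graph `ST_3^n`, obtained from `S^{n+1}` by contracting all non-clique
edges. -/
def sierpinskiTriangleGraph (n : ℕ) :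
    SimpleGraph (Quotient (contractionSetoid (IsNonCliqueEdge (sierpinskiGraph (n + 1))))) :=
  contract (sierpinskiGraph (n + 1)) (IsNonCliqueEdge (sierpinskiGraph (n + 1)))

/-- `f` is a packing `c`-coloring of `G`: it maps the vertex set onto `{1, …, c}`, and any two
distinct vertices of the same color `i` are at distance greater than `i`. -/
def IsPackingColoring {V : Type*} (G : SimpleGraph V) (c : ℕ) (f : V → ℕ) : Prop :=
  Set.range f = Set.Icc 1 c ∧ ∀ u v, u ≠ v → f u = f v → (f u : ℕ∞) < G.edist u v

/-- The packing chromatic number: the least `c` for which `G` has a packing `c`-coloring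
(`⊤` if there is none). -/
noncomputable def packingChromaticNumber {V : Type*} (G : SimpleGraph V) : ℕ∞ :=
  ⨅ (c : ℕ) (_ : ∃ f : V → ℕ, IsPackingColoring G c f), (c : ℕ∞)

end SierpinskiPacking

/-!
Distances in `ST_3^n` obey a recursion on words: a shortest path between two of its three copies of
`ST_3^{n-1}` passes through their common corner or through the third copy.

For the upper bounds we glue explicit colorings of triangles. Whether a gluing is a packing depends
only on the distances from the corners of each copy to the nearest vertices of every color. The
coloring of `ST_3^6` has equal colors at its corners and uses only colors below `2^6`, so that it
can be repeated in all copies of `ST_3^6` in a larger graph.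

For the lower bounds, `ST_3^n` is an isometric subgraph of `ST_3^{n+1}`, so it remains to exclude
11 colors for `ST_3^3`. There the colors `4, …, 7` occur at most three times and larger ones at most
once, since two vertices of the same copy of `ST_3^2` are at distance at most `4` and all distances
are at most `8`. If 7 occurs three times, then at the three corners, and at least 17 vertices have a
color above 3, while at most `3 + 3 + 3 + 3 + 4 = 16` do. If 6 occurs three times, then at a corner
or at one of two triples which are mirror images of each other. In each of these cases, and when 6
and 7 occur at most twice, the few vertices available for the colors above 3 can be enumerated, and
they are always too many for the colors `4, …, 11`.
-/

namespace SierpinskiPacking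

/-! ### Distances -/

/-- The words of length `n + 1`, which represent the vertices of `ST_3^n`. -/
abbrev Word (n : ℕ) := Fin (n + 1) → Fin 3

/-- The vertex of `ST_3^n` represented by a word. -/
def vertex {n : ℕ} (u : Word n) :
    Quotient (contractionSetoid (IsNonCliqueEdge (sierpinskiGraph (n + 1)))) :=
  Quotient.mk _ u

/-- The word `i u`, representing the vertex `u` of the copy `i` of `ST_3^n` in `ST_3^{n+1}`. -/
def cons {n : ℕ} (i : Fin 3) (u : Word n) : Word (n + 1) := Fin.cons i u

/-- The word `j ⋯ j`, representing the corner `j` of `ST_3^n`. -/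
def corner (n : ℕ) (j : Fin 3) : Word n := fun _ => j

/-- The letter different from two given distinct letters. -/
def third (a b : Fin 3) : Fin 3 := -(a + b)

/-- The distance from the corner `j` of `ST_3^n` to the vertex represented by a word. Two distinct
corners of `ST_3^n` are at distance `2 ^ n`. -/
def cornerDist : (n : ℕ) → Fin 3 → Word n → ℕ
  | 0, j, u => if u 0 = j then 0 else 1
  | n + 1, j, u => (if u 0 = j then 0 else 2 ^ n) + cornerDist n j (Fin.tail u)

/-- The distance in `ST_3^n` between the vertices represented by two words. A path between
different copies `i`, `j` of `ST_3^{n-1}` passes through their common corner or through the copy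
`third i j`. -/
def wordDist : (n : ℕ) → Word n → Word n → ℕ
  | 0, u, v => if u 0 = v 0 then 0 else 1
  | n + 1, u, v =>
    if u 0 = v 0 then wordDist n (Fin.tail u) (Fin.tail v)
    else min (cornerDist n (v 0) (Fin.tail u) + cornerDist n (u 0) (Fin.tail v))
      (cornerDist n (third (u 0) (v 0)) (Fin.tail u) + 2 ^ n +
        cornerDist n (third (u 0) (v 0)) (Fin.tail v))

@[simp] lemma cons_zero {n : ℕ} (i : Fin 3) (u : Word n) : cons i u 0 = i := by simp [cons]

@[simp] lemma tail_cons {n : ℕ} (i : Fin 3) (u : Word n) : Fin.tail (cons i u) = u := rfl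

lemma cons_tail {n : ℕ} (u : Word (n + 1)) : cons (u 0) (Fin.tail u) = u := Fin.cons_self_tail u

lemma exists_eq_cons {n : ℕ} (u : Word (n + 1)) : ∃ i u', u = cons i u' :=
  ⟨u 0, Fin.tail u, (cons_tail u).symm⟩

@[simp] lemma corner_apply {n : ℕ} (j : Fin 3) (k : Fin (n + 1)) : corner n j k = j := by
  simp [corner]

@[simp] lemma tail_corner (n : ℕ) (j : Fin 3) : Fin.tail (corner (n + 1) j) = corner n j := rfl

lemma cons_corner (n : ℕ) (j : Fin 3) : cons j (corner n j) = corner (n + 1) j :=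
  cons_tail (corner (n + 1) j)

lemma word_zero_ext {u v : Word 0} (h : u 0 = v 0) : u = v :=
  funext fun k => by rw [Fin.fin_one_eq_zero k]; exact h

lemma third_ne_left : ∀ {a b : Fin 3}, a ≠ b → third a b ≠ a := by decide

lemma third_ne_right : ∀ {a b : Fin 3}, a ≠ b → third a b ≠ b := by decide

lemma third_comm : ∀ a b : Fin 3, third a b = third b a := by decide

lemma eq_third : ∀ {a b c : Fin 3}, a ≠ b → c ≠ a → c ≠ b → c = third a b := by decide

lemma cornerDist_corner_self (n : ℕ) (j : Fin 3) : cornerDist n j (corner n j) = 0 := by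
  induction n with
  | zero => simp [cornerDist]
  | succ n ih => simp [cornerDist, ih]

lemma cornerDist_corner_ne (n : ℕ) {i j : Fin 3} (h : i ≠ j) :
    cornerDist n j (corner n i) = 2 ^ n := by
  induction n with
  | zero => simp [cornerDist, h]
  | succ n ih => simp [cornerDist, ih, h, pow_succ, mul_two]

lemma cornerDist_le (n : ℕ) (j : Fin 3) (u : Word n) : cornerDist n j u ≤ 2 ^ n := by
  induction n with
  | zero => simp only [cornerDist]; split <;> simp
  | succ n ih =>
    have := ih (Fin.tail u)
    simp only [cornerDist, pow_succ]; split <;> omega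

lemma cornerDist_eq_zero {n : ℕ} {j : Fin 3} {u : Word n} :
    cornerDist n j u = 0 ↔ u = corner n j := by
  refine ⟨fun h => ?_, fun h => h ▸ cornerDist_corner_self n j⟩
  induction n with
  | zero => exact word_zero_ext (by simpa [cornerDist] using h)
  | succ n ih =>
    obtain ⟨i, u, rfl⟩ := exists_eq_cons u
    obtain ⟨hi, hu⟩ : i = j ∧ cornerDist n j u = 0 := by simpa [cornerDist] using h
    rw [ih hu, hi, cons_corner]

lemma wordDist_self (n : ℕ) (u : Word n) : wordDist n u u = 0 := by
  induction n with
  | zero => simp [wordDist]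
  | succ n ih => simp [wordDist, ih]

lemma wordDist_comm (n : ℕ) (u v : Word n) : wordDist n u v = wordDist n v u := by
  induction n with
  | zero => simp only [wordDist, eq_comm]
  | succ n ih =>
    simp only [wordDist, eq_comm (a := v 0), third_comm (v 0), ih (Fin.tail v)]
    split_ifs
    · rfl
    · congr 1 <;> omega

lemma wordDist_corner_left (n : ℕ) (j : Fin 3) (u : Word n) :
    wordDist n (corner n j) u = cornerDist n j u := by
  induction n with
  | zero => simp [wordDist, cornerDist, eq_comm]
  | succ n ih =>
    simp only [wordDist, cornerDist, corner_apply, tail_corner]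
    by_cases h : j = u 0
    · rw [if_pos h, if_pos h.symm, ih, zero_add]
    · rw [if_neg h, if_neg (Ne.symm h), cornerDist_corner_ne n h,
        cornerDist_corner_ne n (third_ne_left h).symm]
      have := cornerDist_le n j (Fin.tail u)
      omega

lemma wordDist_corner_right (n : ℕ) (j : Fin 3) (u : Word n) :
    wordDist n u (corner n j) = cornerDist n j u := by
  rw [wordDist_comm, wordDist_corner_left]

lemma adj_zero {u v : Word 0} : (sierpinskiGraph 1).Adj u v ↔ u 0 ≠ v 0 := by
  simp [sierpinskiGraph]

lemma adj_succ {n : ℕ} {u v : Word (n + 1)} :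
    (sierpinskiGraph (n + 2)).Adj u v ↔
      (u 0 = v 0 ∧ (sierpinskiGraph (n + 1)).Adj (Fin.tail u) (Fin.tail v)) ∨
        (u 0 ≠ v 0 ∧ Fin.tail u = corner n (v 0) ∧ Fin.tail v = corner n (u 0)) := by
  rw [sierpinskiGraph]
  simp only [funext_iff, corner]

lemma not_isNonCliqueEdge_zero {u v : Word 0} : ¬ IsNonCliqueEdge (sierpinskiGraph 1) u v := by
  rintro ⟨h, hw⟩
  rw [adj_zero] at h
  exact hw (corner 0 (third (u 0) (v 0)))
    ⟨adj_zero.2 (third_ne_left h).symm, adj_zero.2 (third_ne_right h).symm⟩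

lemma isNonCliqueEdge_succ {n : ℕ} {u v : Word (n + 1)} :
    IsNonCliqueEdge (sierpinskiGraph (n + 2)) u v ↔
      (u 0 = v 0 ∧ IsNonCliqueEdge (sierpinskiGraph (n + 1)) (Fin.tail u) (Fin.tail v)) ∨
        (u 0 ≠ v 0 ∧ Fin.tail u = corner n (v 0) ∧ Fin.tail v = corner n (u 0)) := by
  have corner_injective : ∀ {a b : Fin 3}, corner n a = corner n b → a = b :=
    fun h => congrFun h 0
  constructor
  · rintro ⟨h, hw⟩
    refine (adj_succ.1 h).imp_left fun ⟨h0, h1⟩ => ⟨h0, h1, fun w hww => ?_⟩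
    exact hw (cons (u 0) w) ⟨adj_succ.2 (.inl ⟨by simp, hww.1⟩),
      adj_succ.2 (.inl ⟨by simp [h0], hww.2⟩)⟩
  · rintro (⟨h0, h1, hw⟩ | ⟨h0, h1, h2⟩)
    · refine ⟨adj_succ.2 (.inl ⟨h0, h1⟩), fun w ⟨huw, hvw⟩ => ?_⟩
      rcases adj_succ.1 huw with hu | hu <;> rcases adj_succ.1 hvw with hv | hv
      · exact hw _ ⟨hu.2, hv.2⟩
      · exact hv.1 (h0.symm.trans hu.1)
      · exact hu.1 (h0.trans hv.1)
      · exact h1.ne (hu.2.1.trans hv.2.1.symm)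
    · refine ⟨adj_succ.2 (.inr ⟨h0, h1, h2⟩), fun w ⟨huw, hvw⟩ => ?_⟩
      rcases adj_succ.1 huw with hu | hu <;> rcases adj_succ.1 hvw with hv | hv
      · exact h0 (hu.1.trans hv.1.symm)
      · exact hu.2.ne (h1.trans hv.2.2.symm)
      · exact hv.2.ne (h2.trans hu.2.2.symm)
      · exact h0 (corner_injective (hu.2.2.symm.trans hv.2.2))

lemma cornerDist_eq_of_isNonCliqueEdge {n : ℕ} {v w : Word n} (j : Fin 3)
    (h : IsNonCliqueEdge (sierpinskiGraph (n + 1)) v w) : cornerDist n j v = cornerDist n j w := by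
  induction n with
  | zero => exact absurd h not_isNonCliqueEdge_zero
  | succ n ih =>
    rcases isNonCliqueEdge_succ.1 h with ⟨h0, h1⟩ | ⟨h0, h1, h2⟩
    · simp only [cornerDist, h0, ih h1]
    · simp only [cornerDist, h1, h2]
      by_cases hv : v 0 = j
      · have hw : w 0 ≠ j := fun hw => h0 (hv.trans hw.symm)
        simp [hv, hw, cornerDist_corner_self, cornerDist_corner_ne]
      · by_cases hw : w 0 = j
        · simp [hv, hw, cornerDist_corner_self, cornerDist_corner_ne]
        · simp [hv, hw, cornerDist_corner_ne]

lemma cornerDist_le_of_adj {n : ℕ} {v w : Word n} (j : Fin 3)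
    (h : (sierpinskiGraph (n + 1)).Adj v w) : cornerDist n j w ≤ cornerDist n j v + 1 := by
  induction n with
  | zero => simp only [cornerDist]; split <;> split <;> omega
  | succ n ih =>
    rcases adj_succ.1 h with ⟨h0, h1⟩ | h1
    · simpa only [cornerDist, h0, add_assoc, add_le_add_iff_left] using ih h1
    · rw [cornerDist_eq_of_isNonCliqueEdge j (isNonCliqueEdge_succ.2 (.inr h1))]
      exact Nat.le_succ _

/-- Moving along the edge that joins the copies `i` and `j` costs nothing, seen from the copy
`i`. -/
lemma wordDist_corner_eq_min {n : ℕ} {i j : Fin 3} (h : i ≠ j) (u : Word n) :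
    wordDist n u (corner n j) =
      min (cornerDist n j u + cornerDist n i (corner n i))
        (cornerDist n (third i j) u + 2 ^ n + cornerDist n (third i j) (corner n i)) := by
  rw [wordDist_corner_right, cornerDist_corner_self, cornerDist_corner_ne n (third_ne_left h).symm]
  have := cornerDist_le n j u
  omega

lemma wordDist_eq_of_isNonCliqueEdge {n : ℕ} (u : Word n) {v w : Word n}
    (h : IsNonCliqueEdge (sierpinskiGraph (n + 1)) v w) : wordDist n u v = wordDist n u w := by
  induction n with
  | zero => exact absurd h not_isNonCliqueEdge_zero
  | succ n ih =>
    rcases isNonCliqueEdge_succ.1 h with ⟨h0, h1⟩ | ⟨h0, h1, h2⟩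
    · simp only [wordDist, h0, ih _ h1, cornerDist_eq_of_isNonCliqueEdge _ h1]
    · simp only [wordDist, h1, h2]
      by_cases hv : u 0 = v 0
      · rw [if_pos hv, if_neg (hv ▸ h0), hv, wordDist_corner_eq_min h0]
      · by_cases hw : u 0 = w 0
        · rw [if_neg hv, if_pos hw, hw, wordDist_corner_eq_min h0.symm]
        · rw [if_neg hv, if_neg hw, ← eq_third hv (Ne.symm hw) h0.symm,
            ← eq_third hw (Ne.symm hv) h0, cornerDist_corner_self, cornerDist_corner_self,
            cornerDist_corner_ne n (Ne.symm hv), cornerDist_corner_ne n (Ne.symm hw)]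
          omega

lemma wordDist_le_of_adj {n : ℕ} (u : Word n) {v w : Word n}
    (h : (sierpinskiGraph (n + 1)).Adj v w) : wordDist n u w ≤ wordDist n u v + 1 := by
  induction n with
  | zero => simp only [wordDist]; split <;> split <;> omega
  | succ n ih =>
    rcases adj_succ.1 h with ⟨h0, h1⟩ | h1
    · simp only [wordDist, h0]
      split
      · exact ih (Fin.tail u) h1
      · have := cornerDist_le_of_adj (u 0) h1
        have := cornerDist_le_of_adj (third (u 0) (w 0)) h1
        omega
    · rw [wordDist_eq_of_isNonCliqueEdge u (isNonCliqueEdge_succ.2 (.inr h1))]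
      exact Nat.le_succ _

lemma le_add_edist_of_adj {V : Type*} {G : SimpleGraph V} {f : V → ℕ∞}
    (hf : ∀ a b, G.Adj a b → f b ≤ f a + 1) (a b : V) : f b ≤ f a + G.edist a b := by
  have le_add_length : ∀ {a b : V} (p : G.Walk a b), f b ≤ f a + p.length := by
    intro a b p
    induction p with
    | nil => simp
    | cons hadj p ih =>
      refine (ih.trans (add_le_add_left (hf _ _ hadj) _)).trans_eq ?_
      rw [SimpleGraph.Walk.length_cons, Nat.cast_succ, add_assoc, add_comm 1]
  by_cases h : G.Reachable a b
  · obtain ⟨p, hp⟩ := h.exists_walk_length_eq_edist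
    exact hp ▸ le_add_length p
  · simp [SimpleGraph.edist_eq_top_of_not_reachable h]

section Contract

variable {V : Type*} {G : SimpleGraph V} {r : V → V → Prop}

lemma eq_of_contractionSetoid {α : Type*} {f : V → α} (hf : ∀ v w, r v w → f v = f w) {v w : V}
    (h : contractionSetoid r v w) : f v = f w :=
  Setoid.eqvGen_le (s := Setoid.ker f) hf h

lemma edist_contract_le_one {a b : V} (h : G.Adj a b) :
    (contract G r).edist (Quotient.mk _ a) (Quotient.mk _ b) ≤ 1 := by
  by_cases hab : Quotient.mk (contractionSetoid r) a = Quotient.mk _ b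
  · simp [hab]
  · exact (SimpleGraph.edist_eq_one_iff_adj.2
      (show (contract G r).Adj _ _ from ⟨hab, a, b, h, rfl, rfl⟩)).le

lemma le_add_edist_contract {f : V → ℕ∞} (hr : ∀ v w, r v w → f v = f w)
    (hG : ∀ v w, G.Adj v w → f w ≤ f v + 1) (a b : V) :
    f b ≤ f a + (contract G r).edist (Quotient.mk _ a) (Quotient.mk _ b) := by
  refine le_add_edist_of_adj (G := contract G r)
    (f := Quotient.lift f fun _ _ => eq_of_contractionSetoid hr) ?_ (Quotient.mk _ a) _
  rintro _ _ ⟨-, v, w, hvw, rfl, rfl⟩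
  exact hG v w hvw

end Contract

lemma vertex_eq_of_isNonCliqueEdge {n : ℕ} {u v : Word n}
    (h : IsNonCliqueEdge (sierpinskiGraph (n + 1)) u v) : vertex u = vertex v :=
  Quotient.sound (Relation.EqvGen.rel _ _ h)

lemma edist_vertex_le_one {n : ℕ} {u v : Word n} (h : (sierpinskiGraph (n + 1)).Adj u v) :
    (sierpinskiTriangleGraph n).edist (vertex u) (vertex v) ≤ 1 :=
  edist_contract_le_one h

lemma le_add_edist_vertex {n : ℕ} {f : Word n → ℕ∞}
    (hr : ∀ v w, IsNonCliqueEdge (sierpinskiGraph (n + 1)) v w → f v = f w)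
    (hG : ∀ v w, (sierpinskiGraph (n + 1)).Adj v w → f w ≤ f v + 1) (u v : Word n) :
    f v ≤ f u + (sierpinskiTriangleGraph n).edist (vertex u) (vertex v) :=
  le_add_edist_contract hr hG u v

lemma edist_vertex_cons_le {n : ℕ} (i : Fin 3) (u v : Word n) :
    (sierpinskiTriangleGraph (n + 1)).edist (vertex (cons i u)) (vertex (cons i v)) ≤
      (sierpinskiTriangleGraph n).edist (vertex u) (vertex v) := by
  simpa using le_add_edist_vertex
    (f := fun w =>
      (sierpinskiTriangleGraph (n + 1)).edist (vertex (cons i u)) (vertex (cons i w)))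
    (fun v w h => by
      rw [vertex_eq_of_isNonCliqueEdge (isNonCliqueEdge_succ.2 (.inl ⟨by simp, h⟩) :
        IsNonCliqueEdge _ (cons i v) (cons i w))])
    (fun v w h => SimpleGraph.edist_triangle.trans
      (add_le_add_right (edist_vertex_le_one (adj_succ.2 (.inl ⟨by simp, h⟩))) _)) u v

lemma vertex_cons_corner {n : ℕ} {i j : Fin 3} (h : i ≠ j) :
    vertex (cons i (corner n j)) = vertex (cons j (corner n i)) :=
  vertex_eq_of_isNonCliqueEdge (isNonCliqueEdge_succ.2 (.inr (by simpa using h)))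

lemma edist_vertex_cons_cons_le {n : ℕ} {i j : Fin 3} (h : i ≠ j) (u v : Word n) :
    (sierpinskiTriangleGraph (n + 1)).edist (vertex (cons i u)) (vertex (cons j v)) ≤
      (sierpinskiTriangleGraph n).edist (vertex u) (vertex (corner n j)) +
        (sierpinskiTriangleGraph n).edist (vertex (corner n i)) (vertex v) := by
  refine (SimpleGraph.edist_triangle (v := vertex (cons i (corner n j)))).trans ?_
  gcongr
  · exact edist_vertex_cons_le i u _
  · rw [vertex_cons_corner h]
    exact edist_vertex_cons_le j _ v

lemma edist_vertex_le (n : ℕ) (u v : Word n) :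
    (sierpinskiTriangleGraph n).edist (vertex u) (vertex v) ≤ wordDist n u v := by
  induction n with
  | zero =>
    by_cases h : u 0 = v 0
    · simp [word_zero_ext h]
    · simpa [wordDist, h] using edist_vertex_le_one (adj_zero.2 h)
  | succ n ih =>
    obtain ⟨i, u, rfl⟩ := exists_eq_cons u
    obtain ⟨j, v, rfl⟩ := exists_eq_cons v
    by_cases h : i = j
    · simpa [wordDist, h] using (edist_vertex_cons_le j u v).trans (ih u v)
    have direct : (sierpinskiTriangleGraph (n + 1)).edist (vertex (cons i u)) (vertex (cons j v)) ≤
        ↑(cornerDist n j u + cornerDist n i v) := by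
      rw [Nat.cast_add, ← wordDist_corner_right, ← wordDist_corner_left]
      exact (edist_vertex_cons_cons_le h u v).trans (add_le_add (ih _ _) (ih _ _))
    have detour : (sierpinskiTriangleGraph (n + 1)).edist (vertex (cons i u)) (vertex (cons j v)) ≤
        ↑(cornerDist n (third i j) u + 2 ^ n + cornerDist n (third i j) v) := by
      set k := third i j
      rw [Nat.cast_add, Nat.cast_add, ← wordDist_corner_right, ← wordDist_corner_left n k v,
        ← cornerDist_corner_ne n (Ne.symm h), ← wordDist_corner_left]
      refine (SimpleGraph.edist_triangle (v := vertex (cons k (corner n j)))).trans ?_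
      gcongr
      · exact (edist_vertex_cons_cons_le (third_ne_left h).symm u _).trans
          (add_le_add (ih _ _) (ih _ _))
      · rw [vertex_cons_corner (third_ne_right h)]
        exact (edist_vertex_cons_le j _ v).trans (ih _ _)
    rw [wordDist, if_neg (by simpa using h)]
    simpa only [cons_zero, tail_cons, Nat.mono_cast.map_min, le_min_iff]
      using And.intro direct detour

theorem edist_vertex {n : ℕ} (u v : Word n) :
    (sierpinskiTriangleGraph n).edist (vertex u) (vertex v) = wordDist n u v := by
  refine le_antisymm (edist_vertex_le n u v) ?_
  simpa [wordDist_self] using le_add_edist_vertex (f := fun w => (wordDist n u w : ℕ∞))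
    (fun v w h => by rw [wordDist_eq_of_isNonCliqueEdge u h])
    (fun v w h => by exact_mod_cast wordDist_le_of_adj u h) u v

lemma vertex_eq_iff {n : ℕ} {u v : Word n} : vertex u = vertex v ↔ wordDist n u v = 0 := by
  rw [← SimpleGraph.edist_eq_zero_iff (G := sierpinskiTriangleGraph n), edist_vertex,
    Nat.cast_eq_zero]

/-! ### Packing colorings as colorings of words -/

section PackingColoring

variable {V : Type*} {G : SimpleGraph V} {c : ℕ} {f : V → ℕ}

/-- `f` is a packing coloring of `G` with colors in `{1, …, c}`, not all of which need to occur. -/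
def IsPackingInto (G : SimpleGraph V) (c : ℕ) (f : V → ℕ) : Prop :=
  (∀ v, f v ∈ Set.Icc 1 c) ∧ ∀ u v, u ≠ v → f u = f v → (f u : ℕ∞) < G.edist u v

/-- Recoloring with a smaller color preserves packings, so the largest color can take the place of
a missing one. -/
lemma IsPackingInto.recolor {i : ℕ} (hf : IsPackingInto G (c + 1) f) (hi : i ∈ Set.Icc 1 (c + 1))
    (hif : ∀ v, f v ≠ i) : IsPackingInto G c fun v => if f v = c + 1 then i else f v := by
  refine ⟨fun v => ?_, fun u v huv h => ?_⟩
  · have hv := hf.1 v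
    have hne := hif v
    simp only [Set.mem_Icc] at hi hv ⊢
    split_ifs <;> omega
  · dsimp only at h ⊢
    split_ifs at h ⊢ with hu hv hv
    · refine lt_of_le_of_lt ?_ (hf.2 u v huv (hu.trans hv.symm))
      exact_mod_cast hi.2.trans hu.ge
    · exact absurd h.symm (hif v)
    · exact absurd h (hif u)
    · exact hf.2 u v huv h

lemma IsPackingInto.exists_isPackingColoring [Nonempty V] (hf : IsPackingInto G c f) :
    ∃ c' ≤ c, ∃ f', IsPackingColoring G c' f' := by
  induction c generalizing f with
  | zero => simpa using hf.1 (Classical.arbitrary V)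
  | succ c ih =>
    by_cases hr : Set.Icc 1 (c + 1) ⊆ Set.range f
    · exact ⟨c + 1, le_rfl, f, Set.Subset.antisymm (Set.range_subset_iff.2 hf.1) hr, hf.2⟩
    · obtain ⟨i, hi, hif⟩ := Set.not_subset.1 hr
      obtain ⟨c', hc', h⟩ := ih (hf.recolor hi fun v hv => hif ⟨v, hv⟩)
      exact ⟨c', hc'.trans c.le_succ, h⟩

lemma packingChromaticNumber_le_iff [Nonempty V] :
    packingChromaticNumber G ≤ c ↔ ∃ f, IsPackingInto G c f := by
  constructor
  · intro h
    obtain ⟨c', hc'⟩ := iInf_lt_iff.1 (h.trans_lt (Nat.cast_lt.2 c.lt_succ_self))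
    obtain ⟨⟨f, hf⟩, hlt⟩ := iInf_lt_iff.1 hc'
    have hle : c' ≤ c := Nat.lt_succ_iff.1 (Nat.cast_lt.1 hlt)
    exact ⟨f, fun v => Set.Icc_subset_Icc_right hle (hf.1 ▸ Set.mem_range_self v), hf.2⟩
  · rintro ⟨f, hf⟩
    obtain ⟨c', hc', hf'⟩ := hf.exists_isPackingColoring
    exact (iInf₂_le c' hf').trans (Nat.cast_le.2 hc')

end PackingColoring

/-- `f`, read as a coloring of the vertices of `ST_3^n`, is well defined and a packing coloring
with colors in `{1, …, c}`. -/
structure IsWordPacking {n : ℕ} (c : ℕ) (f : Word n → ℕ) : Prop where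
  mem_Icc : ∀ u, f u ∈ Set.Icc 1 c
  eq_of_wordDist_eq_zero : ∀ {u v}, wordDist n u v = 0 → f u = f v
  lt_wordDist : ∀ {u v}, f u = f v → wordDist n u v ≠ 0 → f u < wordDist n u v

theorem packingChromaticNumber_le_iff_exists_isWordPacking {n c : ℕ} :
    packingChromaticNumber (sierpinskiTriangleGraph n) ≤ c ↔
      ∃ f : Word n → ℕ, IsWordPacking c f := by
  have : Nonempty (Quotient (contractionSetoid (IsNonCliqueEdge (sierpinskiGraph (n + 1))))) :=
    ⟨vertex (corner n 0)⟩
  rw [packingChromaticNumber_le_iff]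
  constructor
  · rintro ⟨f, hf⟩
    refine ⟨fun u => f (vertex u), fun u => hf.1 _, fun h => by rw [vertex_eq_iff.2 h],
      fun {u v} h hne => ?_⟩
    have := hf.2 (vertex u) (vertex v) (mt vertex_eq_iff.1 hne) h
    rwa [edist_vertex, Nat.cast_lt] at this
  · rintro ⟨f, hf⟩
    refine ⟨Quotient.lift f fun u v h => hf.eq_of_wordDist_eq_zero
      (vertex_eq_iff.1 (Quotient.sound h)), ?_, ?_⟩
    · rintro ⟨u⟩
      exact hf.mem_Icc u
    · rintro ⟨u⟩ ⟨v⟩ huv h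
      have := hf.lt_wordDist h (mt vertex_eq_iff.2 huv)
      rwa [← Nat.cast_lt (α := ℕ∞), ← edist_vertex] at this

/-! ### Upper bounds -/

/-- `min a b`, in a form which the kernel evaluates on numerals without unfolding. -/
def natMin (a b : ℕ) : ℕ := a - (a - b)

lemma natMin_eq_min (a b : ℕ) : natMin a b = min a b := tsub_tsub_eq_min a b

/-- The function on `Fin 3` with values `a`, `b`, `c`. The kernel evaluates it in fewer steps than
`![a, b, c]`. -/
def triple {α : Type*} (a b c : α) (i : Fin 3) : α :=
  Nat.rec a (fun k _ => Nat.rec b (fun _ _ => c) k) i.val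

/-- The values of `f` at the cyclic shifts of `(0, 1, 2)`. -/
def cyclic {α : Type*} (f : Fin 3 → Fin 3 → Fin 3 → α) : Fin 3 → α :=
  triple (f 0 1 2) (f 1 2 0) (f 2 0 1)

lemma cyclic_apply {α : Type*} {f : Fin 3 → Fin 3 → Fin 3 → α} (hf : ∀ i j k, f i j k = f i k j)
    {i j : Fin 3} (h : i ≠ j) : cyclic f i = f i j (third i j) := by
  fin_cases i <;> fin_cases j <;> first | exact absurd rfl h | exact hf _ _ _ | rfl

/-- The Boolean universal quantifier over `Fin 3`. -/
def all (p : Fin 3 → Bool) : Bool := p 0 && (p 1 && p 2)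

lemma all_eq_true {p : Fin 3 → Bool} : all p = true ↔ ∀ i, p i = true := by
  simp only [all, Bool.and_eq_true, Fin.forall_fin_succ, Fin.succ_zero_eq_one, Fin.succ_one_eq_two,
    IsEmpty.forall_iff, and_true]

lemma all_cyclic_eq_true {p : Fin 3 → Fin 3 → Fin 3 → Bool} (hp : ∀ i j k, p i j k = p j i k) :
    all (cyclic p) = true ↔ ∀ i j, i ≠ j → p i j (third i j) = true := by
  rw [all_eq_true]
  refine ⟨fun h i j hij => ?_, fun h i => ?_⟩
  · have h₀ : p 0 1 2 = true := h 0
    have h₁ : p 1 2 0 = true := h 1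
    have h₂ : p 2 0 1 = true := h 2
    fin_cases i <;> fin_cases j <;>
      first | exact absurd rfl hij | assumption | exact (hp _ _ _).trans ‹_›
  · fin_cases i
    exacts [h 0 1 (by decide), h 1 2 (by decide), h 2 0 (by decide)]

lemma all_range_eq_true {d : ℕ} {p : ℕ → Bool} :
    (List.range d).all (fun c => p (c + 1)) = true ↔ ∀ c ∈ Set.Icc 1 d, p c = true := by
  rw [List.all_eq_true]
  refine ⟨fun h c hc => ?_, fun h c hc => h _ ⟨Nat.le_add_left _ _, List.mem_range.1 hc⟩⟩
  obtain ⟨c, rfl⟩ := Nat.exists_eq_add_of_le' hc.1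
  exact h c (List.mem_range.2 hc.2)

/-- A coloring of the words of length `n + 1`, arranged along the recursive structure of
`ST_3^n`. -/
inductive ColorTree : ℕ → Type
  | leaf (a : Fin 3 → ℕ) : ColorTree 0
  | node {n : ℕ} (t : Fin 3 → ColorTree n) : ColorTree (n + 1)

namespace ColorTree

variable {n : ℕ} {c d : ℕ}

/-- The color of a word. -/
def color : {n : ℕ} → ColorTree n → Word n → ℕ
  | _, leaf a, u => a (u 0)
  | _, node t, u => (t (u 0)).color (Fin.tail u)

/-- The color of the corner `j`. -/
def cornerColor : {n : ℕ} → ColorTree n → Fin 3 → ℕ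
  | _, leaf a, j => a j
  | _, node t, j => (t j).cornerColor j

/-- All colors lie in `{1, …, d}` and different copies agree on their common corner. -/
def isColoring (d : ℕ) : {n : ℕ} → ColorTree n → Bool
  | _, leaf a => all fun i => Nat.ble 1 (a i) && Nat.ble (a i) d
  | _, node t =>
    all (fun i => (t i).isColoring d) &&
      all (cyclic fun i j _ => Nat.beq ((t i).cornerColor j) ((t j).cornerColor i))

/-- A lower bound on the distance from the corner `j` to the other vertices of color `c`. It is
exact below `c + 1`, the value which stands for the absence of such vertices. -/
def innerDist (c : ℕ) : {n : ℕ} → ColorTree n → Fin 3 → ℕ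
  | _, leaf a =>
    cyclic fun _ i j => bif Nat.beq (a i) c || Nat.beq (a j) c then 1 else c + 1
  | _, @node n t =>
    let nearest (i j : Fin 3) := bif Nat.beq ((t i).cornerColor j) c then 0 else innerDist c (t i) j
    cyclic fun i j k =>
      natMin (innerDist c (t i) i) (2 ^ n + natMin (nearest j i) (nearest k i))

/-- A lower bound on the distance from the corner `j` to the color `c`. -/
def nearestDist (c : ℕ) (t : ColorTree n) (j : Fin 3) : ℕ :=
  bif Nat.beq (t.cornerColor j) c then 0 else innerDist c t j

/-- The vertices of color `c` in the copies `i` and `j`, other than the common corner of these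
copies, are more than `c` apart, both along paths through the common corner and along paths
through the copy `k`. -/
def isSeparated (c : ℕ) (t : Fin 3 → ColorTree n) (i j k : Fin 3) : Bool :=
  Nat.blt c (innerDist c (t i) j + innerDist c (t j) i) &&
    (Nat.blt c (2 ^ n) || (Nat.blt c (innerDist c (t i) j) || (Nat.blt c (innerDist c (t j) i) ||
      Nat.blt c (nearestDist c (t i) k + 2 ^ n + nearestDist c (t j) k))))

/-- Distinct vertices of color `c` are more than `c` apart. -/
def isPacking (c : ℕ) : {n : ℕ} → ColorTree n → Bool
  | _, leaf a => all (cyclic fun i j _ => !(Nat.beq (a i) c && Nat.beq (a j) c))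
  | _, node t => all (fun i => (t i).isPacking c) && all (cyclic (isSeparated c t))

lemma isColoring_node {t : Fin 3 → ColorTree n} :
    (node t).isColoring d = true ↔ (∀ i, (t i).isColoring d = true) ∧
      ∀ i j, i ≠ j → (t i).cornerColor j = (t j).cornerColor i := by
  rw [isColoring, Bool.and_eq_true, all_eq_true, all_cyclic_eq_true]
  · simp only [Nat.beq_eq]
  · exact fun i j _ => Bool.eq_iff_iff.2 (by rw [Nat.beq_eq, Nat.beq_eq, eq_comm])

lemma innerDist_node (t : Fin 3 → ColorTree n) {i j : Fin 3} (h : i ≠ j) :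
    innerDist c (node t) i = min (innerDist c (t i) i)
      (2 ^ n + min (nearestDist c (t j) i) (nearestDist c (t (third i j)) i)) := by
  rw [innerDist, cyclic_apply _ h]
  · simp only [natMin_eq_min, nearestDist]
  · simp only [natMin_eq_min, min_comm, implies_true]

lemma isSeparated_eq_true {t : Fin 3 → ColorTree n} {i j k : Fin 3} :
    isSeparated c t i j k = true ↔ c < innerDist c (t i) j + innerDist c (t j) i ∧
      (c < 2 ^ n ∨ c < innerDist c (t i) j ∨ c < innerDist c (t j) i ∨
        c < nearestDist c (t i) k + 2 ^ n + nearestDist c (t j) k) := by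
  simp only [isSeparated, Bool.and_eq_true, Bool.or_eq_true, Nat.blt_eq]

lemma isSeparated_comm {t : Fin 3 → ColorTree n} (i j k : Fin 3) :
    isSeparated c t i j k = isSeparated c t j i k := by
  rw [Bool.eq_iff_iff, isSeparated_eq_true, isSeparated_eq_true]
  omega

lemma isPacking_node {t : Fin 3 → ColorTree n} :
    (node t).isPacking c = true ↔ (∀ i, (t i).isPacking c = true) ∧
      ∀ i j, i ≠ j → isSeparated c t i j (third i j) = true := by
  rw [isPacking, Bool.and_eq_true, all_eq_true, all_cyclic_eq_true isSeparated_comm]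

lemma color_corner (t : ColorTree n) (j : Fin 3) : t.color (corner n j) = t.cornerColor j := by
  induction t with
  | leaf a => rfl
  | node _ ih => exact ih j

lemma color_mem_Icc {t : ColorTree n} (ht : t.isColoring d = true) (u : Word n) :
    t.color u ∈ Set.Icc 1 d := by
  induction t with
  | leaf a =>
    simp only [isColoring, all_eq_true, Bool.and_eq_true, Nat.ble_eq] at ht
    exact ht (u 0)
  | node t ih => exact ih _ ((isColoring_node.1 ht).1 _) _

lemma color_eq_of_wordDist_eq_zero {t : ColorTree n} (ht : t.isColoring d = true) {u v : Word n}
    (h : wordDist n u v = 0) : t.color u = t.color v := by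
  induction t with
  | leaf a =>
    have : u 0 = v 0 := by simpa [wordDist] using h
    simp only [color, this]
  | @node n t ih =>
    obtain ⟨ht, hcorner⟩ := isColoring_node.1 ht
    simp only [color]
    by_cases huv : u 0 = v 0
    · rw [wordDist, if_pos huv] at h
      rw [huv]
      exact ih _ (ht _) h
    · have : 0 < 2 ^ n := by positivity
      rw [wordDist, if_neg huv] at h
      have hu : cornerDist n (v 0) (Fin.tail u) = 0 := by omega
      have hv : cornerDist n (u 0) (Fin.tail v) = 0 := by omega
      rw [cornerDist_eq_zero.1 hu, cornerDist_eq_zero.1 hv, color_corner, color_corner]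
      exact hcorner _ _ huv

lemma nearestDist_le {t : ColorTree n} {j : Fin 3} {u : Word n} (hu : t.color u = c)
    (h : cornerDist n j u ≠ 0 → innerDist c t j ≤ cornerDist n j u) :
    nearestDist c t j ≤ cornerDist n j u := by
  by_cases hj : cornerDist n j u = 0
  · rw [cornerDist_eq_zero.1 hj, color_corner] at hu
    simp [nearestDist, hu]
  · rw [nearestDist]
    cases Nat.beq (t.cornerColor j) c
    exacts [h hj, Nat.zero_le _]

lemma innerDist_le_cornerDist {t : ColorTree n} {j : Fin 3} {u : Word n} (hu : t.color u = c)
    (h : cornerDist n j u ≠ 0) : innerDist c t j ≤ cornerDist n j u := by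
  induction t with
  | leaf a =>
    have hj : j ≠ u 0 := fun hj => h (by simp [cornerDist, hj])
    rw [innerDist, cyclic_apply (fun _ _ _ => by rw [Bool.or_comm]) hj]
    simp [cornerDist, hj.symm, show a (u 0) = c from hu]
  | @node n t ih =>
    rw [cornerDist] at h ⊢
    by_cases hj : u 0 = j
    · rw [if_pos hj, zero_add] at h ⊢
      obtain ⟨k, hk⟩ := exists_ne j
      rw [innerDist_node t hk.symm]
      subst hj
      exact (min_le_left _ _).trans (ih _ hu h)
    · rw [if_neg hj, innerDist_node t (Ne.symm hj)]
      have nearest := nearestDist_le (u := Fin.tail u) hu (ih _ hu)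
      exact (min_le_right _ _).trans (Nat.add_le_add_left ((min_le_left _ _).trans nearest) _)

lemma lt_cornerDist_add_of_isSeparated {t : Fin 3 → ColorTree n} {i j : Fin 3}
    (h : isSeparated c t i j (third i j) = true) {u v : Word n} (hu : (t i).color u = c)
    (hv : (t j).color v = c) (huj : cornerDist n j u ≠ 0) (hvi : cornerDist n i v ≠ 0) :
    c < cornerDist n j u + cornerDist n i v ∧
      c < cornerDist n (third i j) u + 2 ^ n + cornerDist n (third i j) v := by
  obtain ⟨hdirect, hdetour⟩ := isSeparated_eq_true.1 h
  have := innerDist_le_cornerDist hu huj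
  have := innerDist_le_cornerDist hv hvi
  have := cornerDist_le n j u
  have := cornerDist_le n i v
  have := nearestDist_le (j := third i j) hu (innerDist_le_cornerDist hu)
  have := nearestDist_le (j := third i j) hv (innerDist_le_cornerDist hv)
  omega

lemma lt_wordDist {t : ColorTree n} (ht : t.isColoring d = true) (hc : t.isPacking c = true)
    {u v : Word n} (hu : t.color u = c) (hv : t.color v = c) (huv : wordDist n u v ≠ 0) :
    c < wordDist n u v := by
  induction t with
  | leaf a =>
    have hne : u 0 ≠ v 0 := fun h => huv (by simp [wordDist, h])
    rw [isPacking, all_cyclic_eq_true fun _ _ _ => by rw [Bool.and_comm]] at hc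
    have := hc _ _ hne
    simp only [color] at hu hv
    simp [hu, hv] at this
  | @node n t ih =>
    obtain ⟨htc, hcorner⟩ := isColoring_node.1 ht
    obtain ⟨hpacking, hsep⟩ := isPacking_node.1 hc
    have lt_of_corner {i j : Fin 3} (hij : i ≠ j) {u : Word n} (hu : (t i).color u = c)
        (hj : (t j).color (corner n i) = c) (h : wordDist n u (corner n j) ≠ 0) :
        c < wordDist n u (corner n j) := by
      rw [color_corner, ← hcorner _ _ hij, ← color_corner] at hj
      exact ih i (htc i) (hpacking i) hu hj h
    rw [wordDist] at huv ⊢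
    by_cases h : u 0 = v 0
    · rw [if_pos h] at huv ⊢
      exact ih _ (htc _) (hpacking _) hu (h ▸ hv) huv
    rw [if_neg h] at huv ⊢
    by_cases hvi : cornerDist n (u 0) (Fin.tail v) = 0
    · simp only [color] at hv
      rw [cornerDist_eq_zero.1 hvi] at hv huv ⊢
      rw [← wordDist_corner_eq_min h] at huv ⊢
      exact lt_of_corner h hu hv huv
    by_cases huj : cornerDist n (v 0) (Fin.tail u) = 0
    · simp only [color] at hu
      rw [cornerDist_eq_zero.1 huj] at hu huv ⊢
      have hmin := wordDist_corner_eq_min (Ne.symm h) (Fin.tail v)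
      rw [third_comm] at hmin
      have := lt_of_corner (Ne.symm h) hv hu
      omega
    exact lt_min_iff.2 (lt_cornerDist_add_of_isSeparated (hsep _ _ h) hu hv huj hvi)

/-- All colors lie in `{1, …, d}`, different copies agree on their common corner, and vertices of
the same color `c` are more than `c` apart. -/
def isPackingColoring (d : ℕ) (t : ColorTree n) : Bool :=
  t.isColoring d && (List.range d).all fun c => t.isPacking (c + 1)

lemma isPackingColoring_eq_true {t : ColorTree n} :
    t.isPackingColoring d = true ↔
      t.isColoring d = true ∧ ∀ c ∈ Set.Icc 1 d, t.isPacking c = true := by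
  rw [isPackingColoring, Bool.and_eq_true, all_range_eq_true (p := t.isPacking)]

theorem packingChromaticNumber_le {t : ColorTree n} (ht : t.isPackingColoring d = true) :
    packingChromaticNumber (sierpinskiTriangleGraph n) ≤ d := by
  obtain ⟨ht, hp⟩ := isPackingColoring_eq_true.1 ht
  exact packingChromaticNumber_le_iff_exists_isWordPacking.2 ⟨t.color, color_mem_Icc ht,
    color_eq_of_wordDist_eq_zero ht,
    fun {u _} h => lt_wordDist ht (hp _ (color_mem_Icc ht u)) rfl h.symm⟩

/-- The coloring of `ST_3^{n+k}` whose restriction to each copy of `ST_3^n` is the given one. -/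
def iterate (t : ColorTree n) : (k : ℕ) → ColorTree (n + k)
  | 0 => t
  | k + 1 => node fun _ => t.iterate k

lemma cornerColor_iterate (t : ColorTree n) (k : ℕ) :
    (t.iterate k).cornerColor = t.cornerColor := by
  induction k with
  | zero => rfl
  | succ _ ih => exact ih

lemma min_innerDist_le_innerDist_iterate (t : ColorTree n) (k : ℕ) (j : Fin 3) :
    min (innerDist c t j) (2 ^ n) ≤ innerDist c (t.iterate k) j := by
  induction k with
  | zero => exact min_le_left _ _
  | succ k ih =>
    obtain ⟨i, hi⟩ := exists_ne j
    rw [iterate, innerDist_node _ hi.symm]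
    exact le_min ih ((min_le_right _ _).trans
      ((Nat.pow_le_pow_right two_pos (Nat.le_add_right n k)).trans (Nat.le_add_right _ _)))

lemma isColoring_iterate {t : ColorTree n} (ht : t.isColoring d = true)
    (hcorner : ∀ i j, i ≠ j → t.cornerColor i = t.cornerColor j) (k : ℕ) :
    (t.iterate k).isColoring d = true := by
  induction k with
  | zero => exact ht
  | succ k ih => exact isColoring_node.2 ⟨fun _ => ih, fun i j hij => by
      rw [cornerColor_iterate]; exact (hcorner i j hij).symm⟩

lemma isPacking_iterate {t : ColorTree n} (hc : t.isPacking c = true) (hcn : c < 2 ^ n)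
    (hinner : ∀ i j, i ≠ j → c < innerDist c t i + innerDist c t j) (k : ℕ) :
    (t.iterate k).isPacking c = true := by
  induction k with
  | zero => exact hc
  | succ k ih =>
    refine isPacking_node.2 ⟨fun _ => ih, fun i j hij => isSeparated_eq_true.2
      ⟨?_, .inl (hcn.trans_le (Nat.pow_le_pow_right two_pos (Nat.le_add_right n k)))⟩⟩
    have := hinner i j hij
    have := min_innerDist_le_innerDist_iterate (c := c) t k i
    have := min_innerDist_le_innerDist_iterate (c := c) t k j
    omega

/-- All corners have the same color, and for adjacent copies of the coloring, vertices of the same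
color `c` are more than `c` apart along paths through the common corner. -/
def isPeriodic (d : ℕ) (t : ColorTree n) : Bool :=
  all (cyclic fun i j _ => Nat.beq (t.cornerColor i) (t.cornerColor j)) &&
    (List.range d).all fun c =>
      all (cyclic fun i j _ => Nat.blt (c + 1) (innerDist (c + 1) t i + innerDist (c + 1) t j))

lemma isPeriodic_eq_true {t : ColorTree n} :
    t.isPeriodic d = true ↔ (∀ i j, i ≠ j → t.cornerColor i = t.cornerColor j) ∧
      ∀ c ∈ Set.Icc 1 d, ∀ i j, i ≠ j → c < innerDist c t i + innerDist c t j := by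
  rw [isPeriodic, Bool.and_eq_true, all_range_eq_true (p := fun c =>
    all (cyclic fun i j _ => Nat.blt c (innerDist c t i + innerDist c t j)))]
  refine and_congr ?_ (forall₂_congr fun c _ => ?_)
  · rw [all_cyclic_eq_true fun i j _ => Bool.eq_iff_iff.2 (by rw [Nat.beq_eq, Nat.beq_eq, eq_comm])]
    simp only [Nat.beq_eq]
  · rw [all_cyclic_eq_true fun i j _ => by rw [add_comm]]
    simp only [Nat.blt_eq]

theorem packingChromaticNumber_add_le {t : ColorTree n} (ht : t.isPackingColoring d = true)
    (hperiodic : t.isPeriodic d = true) (hd : d < 2 ^ n) (k : ℕ) :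
    packingChromaticNumber (sierpinskiTriangleGraph (n + k)) ≤ d := by
  obtain ⟨ht, hpacking⟩ := isPackingColoring_eq_true.1 ht
  obtain ⟨hcorner, hinner⟩ := isPeriodic_eq_true.1 hperiodic
  refine packingChromaticNumber_le (isPackingColoring_eq_true.2
    ⟨isColoring_iterate ht hcorner k, fun c hc => ?_⟩)
  exact isPacking_iterate (hpacking c hc) (hc.2.trans_lt hd) (hinner c hc) k

/-- The coloring of a triangle with the given colors of its corners. -/
abbrev tri (a b c : ℕ) : ColorTree 0 := leaf (triple a b c)

/-- The coloring of `ST_3^{n+1}` with the given colorings of its three copies of `ST_3^n`. -/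
abbrev glue (s t w : ColorTree n) : ColorTree (n + 1) := node (triple s t w)

/-- A packing coloring of `ST_3^0` with 3 colors. -/
def coloringZero : ColorTree 0 :=
  tri 1 2 3

/-- A packing coloring of `ST_3^1` with 4 colors. -/
def coloringOne : ColorTree 1 :=
  glue (tri 1 4 3) (tri 4 1 2) (tri 3 2 1)

/-- A packing coloring of `ST_3^2` with 8 colors. -/
def coloringTwo : ColorTree 2 :=
  glue (glue (tri 1 8 2) (tri 8 7 1) (tri 2 1 6)) (glue (tri 7 3 5) (tri 3 2 1) (tri 5 1 4)) (glue
    (tri 6 1 3) (tri 1 4 2) (tri 3 2 1))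

/-- A packing coloring of `ST_3^3` with 12 colors. -/
def coloringThree : ColorTree 3 :=
  glue (glue (glue (tri 7 3 1) (tri 3 1 5) (tri 1 5 2)) (glue (tri 1 4 2) (tri 4 1 6) (tri 2 6 1))
    (glue (tri 2 11 1) (tri 11 1 3) (tri 1 3 9))) (glue (glue (tri 1 2 3) (tri 2 12 1) (tri 3 1 8))
    (glue (tri 12 1 5) (tri 1 2 3) (tri 5 3 1)) (glue (tri 8 2 1) (tri 2 1 4) (tri 1 4 7))) (glue
    (glue (tri 9 1 4) (tri 1 10 2) (tri 4 2 1)) (glue (tri 10 3 1) (tri 3 7 2) (tri 1 2 6)) (glue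
    (tri 1 5 3) (tri 5 6 1) (tri 3 1 2)))

/-- A packing coloring of `ST_3^4` with 15 colors. -/
def coloringFour : ColorTree 4 :=
  glue (glue (glue (glue (tri 1 3 2) (tri 3 9 1) (tri 2 1 7)) (glue (tri 9 2 1) (tri 2 1 5)
    (tri 1 5 4)) (glue (tri 7 1 6) (tri 1 4 2) (tri 6 2 1))) (glue (glue (tri 1 3 12) (tri 3 1 10)
    (tri 12 10 1)) (glue (tri 1 2 6) (tri 2 1 7) (tri 6 7 1)) (glue (tri 1 2 4) (tri 2 1 3)
    (tri 4 3 1))) (glue (glue (tri 1 3 14) (tri 3 11 1) (tri 14 1 2)) (glue (tri 11 2 1) (tri 2 1 5)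
    (tri 1 5 8)) (glue (tri 2 1 4) (tri 1 8 3) (tri 4 3 1)))) (glue (glue (glue (tri 1 5 3)
    (tri 5 15 1) (tri 3 1 2)) (glue (tri 15 2 1) (tri 2 1 3) (tri 1 3 4)) (glue (tri 2 1 8)
    (tri 1 4 9) (tri 8 9 1))) (glue (glue (tri 1 13 6) (tri 13 1 2) (tri 6 2 1)) (glue (tri 1 3 4)
    (tri 3 2 5) (tri 4 5 1)) (glue (tri 1 7 3) (tri 7 1 2) (tri 3 2 10))) (glue (glue (tri 1 3 2)
    (tri 3 1 5) (tri 2 5 1)) (glue (tri 1 14 2) (tri 14 10 1) (tri 2 1 11)) (glue (tri 1 4 6)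
    (tri 4 11 1) (tri 6 1 2)))) (glue (glue (glue (tri 1 2 13) (tri 2 6 1) (tri 13 1 7)) (glue
    (tri 6 3 1) (tri 3 1 9) (tri 1 9 2)) (glue (tri 7 1 3) (tri 1 2 4) (tri 3 4 1))) (glue (glue
    (tri 1 2 5) (tri 2 1 4) (tri 5 4 1)) (glue (tri 1 3 12) (tri 3 2 1) (tri 12 1 7)) (glue
    (tri 1 2 3) (tri 2 7 1) (tri 3 1 8))) (glue (glue (tri 1 5 2) (tri 5 1 10) (tri 2 10 1)) (glue
    (tri 1 2 6) (tri 2 8 1) (tri 6 1 4)) (glue (tri 1 3 15) (tri 3 4 2) (tri 15 2 1))))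

/-- A packing coloring of `ST_3^5` with 19 colors. -/
def coloringFive : ColorTree 5 :=
  glue (glue (glue (glue (glue (tri 3 1 4) (tri 1 6 2) (tri 4 2 1)) (glue (tri 6 10 1) (tri 10 1 3)
    (tri 1 3 2)) (glue (tri 1 11 5) (tri 11 2 1) (tri 5 1 12))) (glue (glue (tri 1 2 4) (tri 2 13 1)
    (tri 4 1 19)) (glue (tri 13 3 1) (tri 3 1 8) (tri 1 8 2)) (glue (tri 19 1 3) (tri 1 2 5)
    (tri 3 5 1))) (glue (glue (tri 12 3 1) (tri 3 1 2) (tri 1 2 7)) (glue (tri 1 6 9) (tri 6 1 2)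
    (tri 9 2 1)) (glue (tri 7 4 1) (tri 4 1 3) (tri 1 3 2)))) (glue (glue (glue (tri 1 7 2)
    (tri 7 1 4) (tri 2 4 1)) (glue (tri 1 3 2) (tri 3 14 1) (tri 2 1 17)) (glue (tri 1 6 5)
    (tri 6 17 1) (tri 5 1 2))) (glue (glue (tri 14 2 1) (tri 2 1 5) (tri 1 5 9)) (glue (tri 1 15 4)
    (tri 15 1 6) (tri 4 6 1)) (glue (tri 9 2 1) (tri 2 1 3) (tri 1 3 8))) (glue (glue (tri 2 3 1)
    (tri 3 1 4) (tri 1 4 11)) (glue (tri 1 2 12) (tri 2 8 1) (tri 12 1 7)) (glue (tri 11 1 2)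
    (tri 1 7 3) (tri 2 3 1)))) (glue (glue (glue (tri 2 5 1) (tri 5 1 8) (tri 1 8 15)) (glue
    (tri 1 2 3) (tri 2 18 1) (tri 3 1 4)) (glue (tri 15 1 2) (tri 1 4 6) (tri 2 6 1))) (glue (glue
    (tri 18 1 10) (tri 1 2 3) (tri 10 3 1)) (glue (tri 2 5 1) (tri 5 1 6) (tri 1 6 4)) (glue
    (tri 1 2 13) (tri 2 4 1) (tri 13 1 9))) (glue (glue (tri 1 14 3) (tri 14 2 1) (tri 3 1 16))
    (glue (tri 2 1 5) (tri 1 9 3) (tri 5 3 1)) (glue (tri 16 4 1) (tri 4 1 2) (tri 1 2 7))))) (glue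
    (glue (glue (glue (tri 1 2 3) (tri 2 7 1) (tri 3 1 10)) (glue (tri 7 1 4) (tri 1 16 2)
    (tri 4 2 1)) (glue (tri 10 5 1) (tri 5 1 13) (tri 1 13 2))) (glue (glue (tri 16 1 3) (tri 1 6 2)
    (tri 3 2 1)) (glue (tri 6 8 1) (tri 8 1 3) (tri 1 3 2)) (glue (tri 1 4 12) (tri 4 2 1)
    (tri 12 1 5))) (glue (glue (tri 2 1 3) (tri 1 9 6) (tri 3 6 1)) (glue (tri 9 1 2) (tri 1 5 3)
    (tri 2 3 1)) (glue (tri 1 4 2) (tri 4 1 7) (tri 2 7 1)))) (glue (glue (glue (tri 1 11 2)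
    (tri 11 1 4) (tri 2 4 1)) (glue (tri 1 3 2) (tri 3 1 14) (tri 2 14 1)) (glue (tri 1 7 3)
    (tri 7 1 5) (tri 3 5 1))) (glue (glue (tri 1 2 9) (tri 2 6 1) (tri 9 1 19)) (glue (tri 6 1 3)
    (tri 1 4 2) (tri 3 2 1)) (glue (tri 19 5 1) (tri 5 1 15) (tri 1 15 2))) (glue (glue (tri 1 10 2)
    (tri 10 1 6) (tri 2 6 1)) (glue (tri 1 3 13) (tri 3 2 1) (tri 13 1 8)) (glue (tri 1 4 18)
    (tri 4 8 1) (tri 18 1 2)))) (glue (glue (glue (tri 1 8 3) (tri 8 2 1) (tri 3 1 5)) (glue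
    (tri 2 1 4) (tri 1 6 3) (tri 4 3 1)) (glue (tri 5 2 1) (tri 2 1 11) (tri 1 11 14))) (glue (glue
    (tri 6 1 2) (tri 1 5 9) (tri 2 9 1)) (glue (tri 5 1 3) (tri 1 2 12) (tri 3 12 1)) (glue
    (tri 1 4 17) (tri 4 1 2) (tri 17 2 1))) (glue (glue (tri 14 1 3) (tri 1 2 4) (tri 3 4 1)) (glue
    (tri 2 7 1) (tri 7 1 3) (tri 1 3 5)) (glue (tri 1 6 2) (tri 6 5 1) (tri 2 1 10))))) (glue (glue
    (glue (glue (tri 7 1 3) (tri 1 2 12) (tri 3 12 1)) (glue (tri 2 1 5) (tri 1 10 3) (tri 5 3 1))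
    (glue (tri 1 2 6) (tri 2 1 4) (tri 6 4 1))) (glue (glue (tri 10 1 8) (tri 1 4 2) (tri 8 2 1))
    (glue (tri 4 3 1) (tri 3 1 2) (tri 1 2 11)) (glue (tri 1 6 19) (tri 6 11 1) (tri 19 1 2))) (glue
    (glue (tri 1 2 3) (tri 2 9 1) (tri 3 1 17)) (glue (tri 9 1 5) (tri 1 2 3) (tri 5 3 1)) (glue
    (tri 17 2 1) (tri 2 1 4) (tri 1 4 7)))) (glue (glue (glue (tri 1 7 5) (tri 7 1 2) (tri 5 2 1))
    (glue (tri 1 3 4) (tri 3 15 1) (tri 4 1 2)) (glue (tri 1 13 3) (tri 13 2 1) (tri 3 1 6))) (glue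
    (glue (tri 15 2 1) (tri 2 1 9) (tri 1 9 5)) (glue (tri 1 3 4) (tri 3 10 1) (tri 4 1 2)) (glue
    (tri 5 1 3) (tri 1 2 16) (tri 3 16 1))) (glue (glue (tri 6 1 2) (tri 1 4 12) (tri 2 12 1)) (glue
    (tri 4 2 1) (tri 2 1 8) (tri 1 8 7)) (glue (tri 1 3 5) (tri 3 7 1) (tri 5 1 2)))) (glue (glue
    (glue (tri 7 2 1) (tri 2 1 6) (tri 1 6 3)) (glue (tri 1 5 14) (tri 5 3 1) (tri 14 1 2)) (glue
    (tri 3 1 8) (tri 1 2 4) (tri 8 4 1))) (glue (glue (tri 3 2 1) (tri 2 1 10) (tri 1 10 9)) (glue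
    (tri 1 4 11) (tri 4 2 1) (tri 11 1 3)) (glue (tri 9 1 18) (tri 1 3 2) (tri 18 2 1))) (glue (glue
    (tri 1 2 13) (tri 2 3 1) (tri 13 1 15)) (glue (tri 3 5 1) (tri 5 1 4) (tri 1 4 7)) (glue
    (tri 15 1 2) (tri 1 7 6) (tri 2 6 1)))))

/-- A packing coloring of `ST_3^6` with 20 colors, which can be repeated periodically. -/
def coloringSix : ColorTree 6 :=
  glue (glue (glue (glue (glue (glue (tri 14 1 10) (tri 1 5 2) (tri 10 2 1)) (glue (tri 5 3 1)
    (tri 3 1 8) (tri 1 8 2)) (glue (tri 1 4 3) (tri 4 2 1) (tri 3 1 6))) (glue (glue (tri 1 2 9)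
    (tri 2 1 4) (tri 9 4 1)) (glue (tri 1 3 6) (tri 3 1 5) (tri 6 5 1)) (glue (tri 1 2 3)
    (tri 2 1 19) (tri 3 19 1))) (glue (glue (tri 6 2 1) (tri 2 1 5) (tri 1 5 11)) (glue (tri 1 12 4)
    (tri 12 1 2) (tri 4 2 1)) (glue (tri 11 3 1) (tri 3 1 7) (tri 1 7 2)))) (glue (glue (glue
    (tri 1 2 7) (tri 2 1 4) (tri 7 4 1)) (glue (tri 1 3 10) (tri 3 1 11) (tri 10 11 1)) (glue
    (tri 1 16 3) (tri 16 1 2) (tri 3 2 1))) (glue (glue (tri 1 2 5) (tri 2 6 4) (tri 5 4 1)) (glue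
    (tri 6 1 3) (tri 1 2 7) (tri 3 7 1)) (glue (tri 1 2 9) (tri 2 1 17) (tri 9 17 1))) (glue (glue
    (tri 1 5 8) (tri 5 1 2) (tri 8 2 1)) (glue (tri 1 3 4) (tri 3 1 2) (tri 4 2 1)) (glue
    (tri 1 6 3) (tri 6 1 12) (tri 3 12 1)))) (glue (glue (glue (tri 2 20 1) (tri 20 1 3)
    (tri 1 3 4)) (glue (tri 1 2 6) (tri 2 1 9) (tri 6 9 1)) (glue (tri 4 5 1) (tri 5 1 2)
    (tri 1 2 8))) (glue (glue (tri 1 3 13) (tri 3 1 4) (tri 13 4 1)) (glue (tri 1 2 7) (tri 2 1 18)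
    (tri 7 18 1)) (glue (tri 1 2 5) (tri 2 1 3) (tri 5 3 1))) (glue (glue (tri 8 3 1) (tri 3 1 15)
    (tri 1 15 2)) (glue (tri 1 2 10) (tri 2 1 6) (tri 10 6 1)) (glue (tri 2 4 1) (tri 4 1 3)
    (tri 1 3 14))))) (glue (glue (glue (glue (tri 2 8 1) (tri 8 1 3) (tri 1 3 13)) (glue (tri 1 2 5)
    (tri 2 1 14) (tri 5 14 1)) (glue (tri 13 4 1) (tri 4 1 2) (tri 1 2 15))) (glue (glue (tri 1 6 3)
    (tri 6 2 1) (tri 3 1 4)) (glue (tri 2 1 7) (tri 1 11 3) (tri 7 3 1)) (glue (tri 4 2 1)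
    (tri 2 1 9) (tri 1 9 5))) (glue (glue (tri 15 1 3) (tri 1 10 2) (tri 3 2 1)) (glue (tri 10 1 20)
    (tri 1 5 3) (tri 20 3 1)) (glue (tri 1 6 4) (tri 6 1 2) (tri 4 2 1)))) (glue (glue (glue
    (tri 11 4 1) (tri 4 1 2) (tri 1 2 5)) (glue (tri 1 3 18) (tri 3 6 1) (tri 18 1 2)) (glue
    (tri 5 1 3) (tri 1 2 12) (tri 3 12 1))) (glue (glue (tri 6 1 2) (tri 1 5 13) (tri 2 13 1)) (glue
    (tri 5 2 1) (tri 2 1 3) (tri 1 3 15)) (glue (tri 1 4 10) (tri 4 15 1) (tri 10 1 2))) (glue (glue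
    (tri 1 2 4) (tri 2 1 7) (tri 4 7 1)) (glue (tri 1 3 8) (tri 3 2 1) (tri 8 1 5)) (glue
    (tri 1 2 6) (tri 2 5 1) (tri 6 1 3)))) (glue (glue (glue (tri 1 3 8) (tri 3 1 5) (tri 8 5 2))
    (glue (tri 1 7 2) (tri 7 11 1) (tri 2 1 4)) (glue (tri 2 1 19) (tri 1 4 3) (tri 19 3 1))) (glue
    (glue (tri 11 1 3) (tri 1 2 16) (tri 3 16 1)) (glue (tri 2 1 4) (tri 1 3 9) (tri 4 9 1)) (glue
    (tri 1 2 5) (tri 2 1 17) (tri 5 17 1))) (glue (glue (tri 1 2 12) (tri 2 1 6) (tri 12 6 1)) (glue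
    (tri 1 3 4) (tri 3 1 2) (tri 4 2 1)) (glue (tri 1 10 2) (tri 10 1 7) (tri 2 7 1))))) (glue (glue
    (glue (glue (tri 14 1 5) (tri 1 7 2) (tri 5 2 1)) (glue (tri 7 3 1) (tri 3 1 9) (tri 1 9 2))
    (glue (tri 1 4 3) (tri 4 2 1) (tri 3 1 11))) (glue (glue (tri 1 2 6) (tri 2 4 1) (tri 6 1 12))
    (glue (tri 4 1 8) (tri 1 2 10) (tri 8 10 1)) (glue (tri 12 3 1) (tri 3 1 2) (tri 1 2 5))) (glue
    (glue (tri 11 17 1) (tri 17 1 2) (tri 1 2 6)) (glue (tri 1 4 3) (tri 4 5 1) (tri 3 1 7)) (glue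
    (tri 6 1 13) (tri 1 7 2) (tri 13 2 1)))) (glue (glue (glue (tri 2 3 1) (tri 3 1 5) (tri 1 5 7))
    (glue (tri 1 2 4) (tri 2 1 18) (tri 4 18 1)) (glue (tri 7 2 1) (tri 2 1 3) (tri 1 3 11))) (glue
    (glue (tri 1 9 3) (tri 9 2 1) (tri 3 1 6)) (glue (tri 2 5 1) (tri 5 1 3) (tri 1 3 4)) (glue
    (tri 6 1 2) (tri 1 4 13) (tri 2 13 1))) (glue (glue (tri 11 1 2) (tri 1 15 4) (tri 2 4 1)) (glue
    (tri 15 3 1) (tri 3 1 8) (tri 1 8 2)) (glue (tri 1 5 3) (tri 5 2 1) (tri 3 1 14)))) (glue (glue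
    (glue (tri 1 19 3) (tri 19 1 8) (tri 3 8 1)) (glue (tri 1 9 2) (tri 9 1 3) (tri 2 3 1)) (glue
    (tri 1 4 5) (tri 4 1 16) (tri 5 16 1))) (glue (glue (tri 1 2 10) (tri 2 7 1) (tri 10 1 5)) (glue
    (tri 7 6 1) (tri 6 14 2) (tri 1 2 4)) (glue (tri 5 1 2) (tri 1 4 3) (tri 2 3 1))) (glue (glue
    (tri 1 3 2) (tri 3 1 6) (tri 2 6 1)) (glue (tri 1 12 2) (tri 12 1 20) (tri 2 20 1)) (glue
    (tri 1 4 7) (tri 4 1 3) (tri 7 3 1)))))) (glue (glue (glue (glue (glue (tri 1 9 7) (tri 9 1 4)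
    (tri 7 4 1)) (glue (tri 1 3 6) (tri 3 1 5) (tri 6 5 1)) (glue (tri 1 2 3) (tri 2 1 11)
    (tri 3 11 1))) (glue (glue (tri 1 8 2) (tri 8 1 4) (tri 2 4 1)) (glue (tri 1 3 2) (tri 3 1 7)
    (tri 2 7 1)) (glue (tri 1 12 3) (tri 12 1 10) (tri 3 10 1))) (glue (glue (tri 1 2 14)
    (tri 2 4 1) (tri 14 1 19)) (glue (tri 4 16 1) (tri 16 1 5) (tri 1 5 6)) (glue (tri 19 1 2)
    (tri 1 6 3) (tri 2 3 1)))) (glue (glue (glue (tri 1 2 5) (tri 2 4 1) (tri 5 1 6)) (glue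
    (tri 4 3 1) (tri 3 1 13) (tri 1 13 2)) (glue (tri 6 1 3) (tri 1 2 9) (tri 3 9 1))) (glue (glue
    (tri 1 18 2) (tri 18 1 5) (tri 2 5 1)) (glue (tri 1 3 2) (tri 3 1 11) (tri 2 11 1)) (glue
    (tri 1 14 4) (tri 14 1 6) (tri 4 6 1))) (glue (glue (tri 1 17 2) (tri 17 8 1) (tri 2 1 4)) (glue
    (tri 8 2 1) (tri 2 1 3) (tri 1 3 10)) (glue (tri 4 1 5) (tri 1 10 2) (tri 5 2 1)))) (glue (glue
    (glue (tri 1 20 7) (tri 20 2 1) (tri 7 1 4)) (glue (tri 2 3 1) (tri 3 1 5) (tri 1 5 9)) (glue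
    (tri 4 1 3) (tri 1 9 2) (tri 3 2 1))) (glue (glue (tri 1 4 2) (tri 4 6 1) (tri 2 1 15)) (glue
    (tri 6 3 1) (tri 3 1 7) (tri 1 7 2)) (glue (tri 15 1 3) (tri 1 2 12) (tri 3 12 1))) (glue (glue
    (tri 1 8 13) (tri 8 1 2) (tri 13 2 1)) (glue (tri 1 11 4) (tri 11 1 2) (tri 4 2 1)) (glue
    (tri 1 5 3) (tri 5 1 6) (tri 3 6 1))))) (glue (glue (glue (glue (tri 1 2 7) (tri 2 1 12)
    (tri 7 12 1)) (glue (tri 1 3 4) (tri 3 1 19) (tri 4 19 1)) (glue (tri 1 5 3) (tri 5 1 2)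
    (tri 3 2 1))) (glue (glue (tri 1 2 10) (tri 2 6 1) (tri 10 1 20)) (glue (tri 6 1 3) (tri 1 16 7)
    (tri 3 7 1)) (glue (tri 20 4 1) (tri 4 1 2) (tri 1 2 5))) (glue (glue (tri 1 6 9) (tri 6 1 2)
    (tri 9 2 1)) (glue (tri 1 3 8) (tri 3 5 1) (tri 8 1 2)) (glue (tri 1 4 3) (tri 4 2 1)
    (tri 3 1 15)))) (glue (glue (glue (tri 16 2 1) (tri 2 1 3) (tri 1 3 5)) (glue (tri 1 9 4)
    (tri 9 1 2) (tri 4 2 1)) (glue (tri 5 8 1) (tri 8 1 11) (tri 1 11 2))) (glue (glue (tri 1 6 3)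
    (tri 6 2 1) (tri 3 1 5)) (glue (tri 2 1 13) (tri 1 14 3) (tri 13 3 1)) (glue (tri 5 4 1)
    (tri 4 1 2) (tri 1 2 17))) (glue (glue (tri 2 1 3) (tri 1 12 4) (tri 3 4 1)) (glue (tri 12 1 2)
    (tri 1 17 3) (tri 2 3 1)) (glue (tri 1 6 2) (tri 6 1 7) (tri 2 7 1)))) (glue (glue (glue
    (tri 15 2 1) (tri 2 1 7) (tri 1 7 5)) (glue (tri 1 6 4) (tri 6 3 1) (tri 4 1 2)) (glue
    (tri 5 1 3) (tri 1 2 14) (tri 3 14 1))) (glue (glue (tri 3 10 1) (tri 10 1 2) (tri 1 2 8)) (glue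
    (tri 1 5 4) (tri 5 1 3) (tri 4 3 1)) (glue (tri 8 9 1) (tri 9 1 2) (tri 1 2 18))) (glue (glue
    (tri 1 11 2) (tri 11 1 4) (tri 2 4 1)) (glue (tri 1 3 2) (tri 3 18 1) (tri 2 1 5)) (glue
    (tri 1 6 3) (tri 6 5 1) (tri 3 1 2))))) (glue (glue (glue (glue (tri 1 2 10) (tri 2 4 1)
    (tri 10 1 7)) (glue (tri 4 3 1) (tri 3 1 9) (tri 1 9 2)) (glue (tri 7 1 3) (tri 1 2 5)
    (tri 3 5 1))) (glue (glue (tri 1 14 2) (tri 14 1 6) (tri 2 6 1)) (glue (tri 1 2 3) (tri 2 16 1)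
    (tri 3 1 7)) (glue (tri 1 4 5) (tri 4 7 1) (tri 5 1 2))) (glue (glue (tri 1 4 2) (tri 4 1 18)
    (tri 2 18 6)) (glue (tri 1 3 8) (tri 3 2 1) (tri 8 1 17)) (glue (tri 6 1 3) (tri 1 17 2)
    (tri 3 2 1)))) (glue (glue (glue (tri 16 1 11) (tri 1 2 3) (tri 11 3 1)) (glue (tri 2 1 19)
    (tri 1 10 6) (tri 19 6 1)) (glue (tri 1 2 5) (tri 2 1 4) (tri 5 4 1))) (glue (glue (tri 10 3 1)
    (tri 3 1 2) (tri 1 2 8)) (glue (tri 1 7 12) (tri 7 2 1) (tri 12 1 4)) (glue (tri 8 1 5)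
    (tri 1 4 2) (tri 5 2 1))) (glue (glue (tri 1 2 3) (tri 2 9 1) (tri 3 1 7)) (glue (tri 9 13 1)
    (tri 13 1 3) (tri 1 3 2)) (glue (tri 7 1 20) (tri 1 2 4) (tri 20 4 1)))) (glue (glue (glue
    (tri 1 5 4) (tri 5 7 1) (tri 4 1 2)) (glue (tri 7 3 1) (tri 3 1 2) (tri 1 2 9)) (glue
    (tri 2 1 3) (tri 1 9 12) (tri 3 12 1))) (glue (glue (tri 1 10 4) (tri 10 6 2) (tri 4 2 1)) (glue
    (tri 6 3 1) (tri 3 1 2) (tri 1 2 5)) (glue (tri 1 8 3) (tri 8 5 1) (tri 3 1 2))) (glue (glue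
    (tri 1 2 6) (tri 2 4 1) (tri 6 1 15)) (glue (tri 4 1 11) (tri 1 2 14) (tri 11 14 1)) (glue
    (tri 15 2 5) (tri 2 1 3) (tri 5 3 1)))))) (glue (glue (glue (glue (glue (tri 1 2 5) (tri 2 1 11)
    (tri 5 11 1)) (glue (tri 1 3 4) (tri 3 2 1) (tri 4 1 9)) (glue (tri 1 2 3) (tri 2 9 1)
    (tri 3 1 10))) (glue (glue (tri 2 6 1) (tri 6 1 18) (tri 1 18 5)) (glue (tri 1 4 2) (tri 4 1 7)
    (tri 2 7 1)) (glue (tri 5 3 1) (tri 3 1 17) (tri 1 17 2))) (glue (glue (tri 10 2 1) (tri 2 1 13)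
    (tri 1 13 6)) (glue (tri 1 4 3) (tri 4 2 1) (tri 3 1 8)) (glue (tri 6 1 5) (tri 1 8 2)
    (tri 5 2 1)))) (glue (glue (glue (tri 1 3 2) (tri 3 1 12) (tri 2 12 1)) (glue (tri 1 8 2)
    (tri 8 1 4) (tri 2 4 1)) (glue (tri 1 10 5) (tri 10 1 3) (tri 5 3 1))) (glue (glue (tri 1 2 3)
    (tri 2 15 1) (tri 3 1 11)) (glue (tri 15 6 1) (tri 6 1 4) (tri 1 4 13)) (glue (tri 11 1 5)
    (tri 1 13 2) (tri 5 2 1))) (glue (glue (tri 1 6 16) (tri 6 2 1) (tri 16 1 9)) (glue (tri 2 3 1)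
    (tri 3 1 7) (tri 1 7 4)) (glue (tri 9 1 3) (tri 1 4 2) (tri 3 2 1)))) (glue (glue (glue
    (tri 1 3 4) (tri 3 2 1) (tri 4 1 15)) (glue (tri 2 7 1) (tri 7 1 19) (tri 1 19 12)) (glue
    (tri 15 2 1) (tri 2 12 3) (tri 1 3 9))) (glue (glue (tri 1 3 2) (tri 3 1 14) (tri 2 14 1)) (glue
    (tri 1 5 2) (tri 5 1 8) (tri 2 8 1)) (glue (tri 1 6 4) (tri 6 1 3) (tri 4 3 1))) (glue (glue
    (tri 9 5 1) (tri 5 1 2) (tri 1 2 4)) (glue (tri 1 10 11) (tri 10 1 2) (tri 11 2 1)) (glue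
    (tri 4 3 1) (tri 3 1 7) (tri 1 7 2))))) (glue (glue (glue (glue (tri 1 2 3) (tri 2 9 1)
    (tri 3 1 5)) (glue (tri 9 1 7) (tri 1 2 3) (tri 7 3 1)) (glue (tri 5 2 1) (tri 2 1 4)
    (tri 1 4 14))) (glue (glue (tri 2 8 1) (tri 8 1 12) (tri 1 12 5)) (glue (tri 1 4 2) (tri 4 6 1)
    (tri 2 1 3)) (glue (tri 5 1 2) (tri 1 3 11) (tri 2 11 1))) (glue (glue (tri 14 3 1) (tri 3 1 6)
    (tri 1 6 2)) (glue (tri 1 20 2) (tri 20 1 4) (tri 2 4 1)) (glue (tri 2 10 1) (tri 10 1 3)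
    (tri 1 3 5)))) (glue (glue (glue (tri 6 1 2) (tri 1 5 3) (tri 2 3 7)) (glue (tri 5 2 1)
    (tri 2 1 19) (tri 1 19 4)) (glue (tri 7 1 17) (tri 1 4 2) (tri 17 2 1))) (glue (glue
    (tri 1 3 10) (tri 3 1 13) (tri 10 13 1)) (glue (tri 1 2 4) (tri 2 1 7) (tri 4 7 1)) (glue
    (tri 1 2 6) (tri 2 1 3) (tri 6 3 1))) (glue (glue (tri 1 3 9) (tri 3 5 1) (tri 9 1 2)) (glue
    (tri 5 16 1) (tri 16 1 2) (tri 1 2 4)) (glue (tri 2 1 8) (tri 1 4 3) (tri 8 3 1)))) (glue (glue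
    (glue (tri 5 2 1) (tri 2 1 4) (tri 1 4 9)) (glue (tri 1 7 3) (tri 7 18 1) (tri 3 1 2)) (glue
    (tri 9 1 8) (tri 1 2 6) (tri 8 6 1))) (glue (glue (tri 18 1 2) (tri 1 5 3) (tri 2 3 1)) (glue
    (tri 5 11 1) (tri 11 1 2) (tri 1 2 6)) (glue (tri 1 12 4) (tri 12 6 1) (tri 4 1 2))) (glue (glue
    (tri 1 2 3) (tri 2 5 1) (tri 3 1 4)) (glue (tri 5 1 15) (tri 1 2 3) (tri 15 3 1)) (glue
    (tri 4 2 1) (tri 2 1 7) (tri 1 7 13))))) (glue (glue (glue (glue (tri 2 6 1) (tri 6 1 3)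
    (tri 1 3 8)) (glue (tri 1 2 5) (tri 2 1 20) (tri 5 20 1)) (glue (tri 8 4 1) (tri 4 1 2)
    (tri 1 2 13))) (glue (glue (tri 1 17 3) (tri 17 1 2) (tri 3 2 1)) (glue (tri 1 4 7) (tri 4 2 1)
    (tri 7 1 5)) (glue (tri 1 12 10) (tri 12 5 1) (tri 10 1 2))) (glue (glue (tri 13 1 3)
    (tri 1 9 2) (tri 3 2 1)) (glue (tri 9 1 6) (tri 1 2 3) (tri 6 3 1)) (glue (tri 1 4 5)
    (tri 4 1 2) (tri 5 2 1)))) (glue (glue (glue (tri 2 1 3) (tri 1 11 14) (tri 3 14 1)) (glue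
    (tri 11 1 2) (tri 1 9 3) (tri 2 3 1)) (glue (tri 1 6 2) (tri 6 1 4) (tri 2 4 1))) (glue (glue
    (tri 9 5 1) (tri 5 1 4) (tri 1 4 2)) (glue (tri 1 3 2) (tri 3 13 1) (tri 2 1 10)) (glue
    (tri 2 1 8) (tri 1 10 6) (tri 8 6 1))) (glue (glue (tri 1 5 3) (tri 5 19 1) (tri 3 1 2)) (glue
    (tri 19 2 1) (tri 2 1 3) (tri 1 3 4)) (glue (tri 2 1 7) (tri 1 4 16) (tri 7 16 1)))) (glue (glue
    (glue (tri 1 7 3) (tri 7 1 11) (tri 3 11 1)) (glue (tri 1 2 4) (tri 2 1 3) (tri 4 3 1)) (glue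
    (tri 1 2 8) (tri 2 1 6) (tri 8 6 1))) (glue (glue (tri 1 5 18) (tri 5 1 2) (tri 18 2 1)) (glue
    (tri 1 3 12) (tri 3 1 2) (tri 12 2 6)) (glue (tri 1 9 4) (tri 9 6 1) (tri 4 1 2))) (glue (glue
    (tri 1 2 3) (tri 2 5 1) (tri 3 1 4)) (glue (tri 5 1 15) (tri 1 2 3) (tri 15 3 1)) (glue
    (tri 4 2 1) (tri 2 1 7) (tri 1 7 14))))))

end ColorTree

theorem packingChromaticNumber_zero_le :
    packingChromaticNumber (sierpinskiTriangleGraph 0) ≤ 3 :=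
  ColorTree.packingChromaticNumber_le (t := .coloringZero) (by decide +kernel)

theorem packingChromaticNumber_one_le :
    packingChromaticNumber (sierpinskiTriangleGraph 1) ≤ 4 :=
  ColorTree.packingChromaticNumber_le (t := .coloringOne) (by decide +kernel)

theorem packingChromaticNumber_two_le :
    packingChromaticNumber (sierpinskiTriangleGraph 2) ≤ 8 :=
  ColorTree.packingChromaticNumber_le (t := .coloringTwo) (by decide +kernel)

theorem packingChromaticNumber_three_le :
    packingChromaticNumber (sierpinskiTriangleGraph 3) ≤ 12 :=
  ColorTree.packingChromaticNumber_le (t := .coloringThree) (by decide +kernel)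

theorem packingChromaticNumber_four_le :
    packingChromaticNumber (sierpinskiTriangleGraph 4) ≤ 15 :=
  ColorTree.packingChromaticNumber_le (t := .coloringFour) (by decide +kernel)

theorem packingChromaticNumber_five_le :
    packingChromaticNumber (sierpinskiTriangleGraph 5) ≤ 19 :=
  ColorTree.packingChromaticNumber_le (t := .coloringFive) (by decide +kernel)

theorem packingChromaticNumber_six_add_le (k : ℕ) :
    packingChromaticNumber (sierpinskiTriangleGraph (6 + k)) ≤ 20 :=
  ColorTree.packingChromaticNumber_add_le (t := .coloringSix) (by decide +kernel)
    (by decide +kernel) (by norm_num) k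

/-! ### Lower bounds -/

/-- The value `f n`, in a form for which the kernel replaces `n` by a numeral before it evaluates
`f`, so that it recognizes arguments with the same value and evaluates `f` only once for them. -/
def force (f : ℕ → ℕ) (n : ℕ) : ℕ := Nat.rec (f 0) (fun n _ => f (Nat.succ n)) n

lemma force_eq (f : ℕ → ℕ) (n : ℕ) : force f n = f n := by cases n <;> rfl

/-- The minimum of `m` and of the values of `f` at the elements of `ks` which satisfy `p`. -/
def minWhere (p : ℕ → Bool) (f : ℕ → ℕ) (ks : List ℕ) (m : ℕ) : ℕ :=
  List.rec m (fun k _ m => bif p k then natMin m (f k) else m) ks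

lemma minWhere_cons (p : ℕ → Bool) (f : ℕ → ℕ) (k : ℕ) (ks : List ℕ) (m : ℕ) :
    minWhere p f (k :: ks) m =
      if p k then min (minWhere p f ks m) (f k) else minWhere p f ks m := by
  rw [← natMin_eq_min, ← Bool.cond_eq_ite]
  rfl

lemma minWhere_le_init (p : ℕ → Bool) (f : ℕ → ℕ) (ks : List ℕ) (m : ℕ) :
    minWhere p f ks m ≤ m := by
  induction ks with
  | nil => exact le_rfl
  | cons k ks ih =>
    rw [minWhere_cons]
    split
    exacts [(min_le_left _ _).trans ih, ih]

lemma minWhere_le {p : ℕ → Bool} {f : ℕ → ℕ} {ks : List ℕ} {k : ℕ} (hk : k ∈ ks)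
    (hp : p k = true) (m : ℕ) : minWhere p f ks m ≤ f k := by
  induction ks with
  | nil => exact absurd hk List.not_mem_nil
  | cons k' ks ih =>
    rw [minWhere_cons]
    rcases List.mem_cons.1 hk with rfl | hk
    · exact (if_pos hp).trans_le (min_le_right _ _)
    · split
      exacts [(min_le_left _ _).trans (ih hk), ih hk]

section MinOutside

variable {V : Type*} {dist : V → V → ℕ} {g : V → ℕ} {ks : List ℕ} {l : List V}

/-- In `a`, the color `k` is not forbidden for the first vertex. Sets of forbidden colors, one for
each vertex of a list, are encoded as a number whose `i`-th digit in base `256` has the bit `k` if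
the color `k < 8` is forbidden for the `i`-th vertex. -/
def isFree (a k : ℕ) : Bool := Nat.beq (Nat.land a (2 ^ k)) 0

/-- The encoding of the colors which are forbidden for the vertices of `l` after `v` received the
color `k`. -/
def blocked (dist : V → V → ℕ) (k : ℕ) (v : V) (l : List V) : ℕ :=
  l.foldr (fun u m => 256 * m + bif Nat.ble (dist v u) k then 2 ^ k else 0) 0

/-- The least number of vertices of `l` with a color outside `ks` in a packing coloring of `l` in
which the colors encoded by `a` are forbidden. -/
def minOutside (dist : V → V → ℕ) (ks : List ℕ) : List V → ℕ → ℕ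
  | [] => fun _ => 0
  | v :: l => fun a =>
    minWhere (isFree a) (fun k => force (minOutside dist ks l) (a / 256 ||| blocked dist k v l)) ks
      (force (minOutside dist ks l) (a / 256) + 1)

/-- Vertices of the list with the same color `k` are more than `k` apart. -/
def IsPackingOn (dist : V → V → ℕ) (g : V → ℕ) (l : List V) : Prop :=
  l.Pairwise fun u v => g u = g v → g u < dist u v

/-- Those colors of the vertices of the list which belong to `ks` are not forbidden by `a`. -/
def IsAllowed (g : V → ℕ) (ks : List ℕ) : List V → ℕ → Prop
  | [], _ => True
  | v :: l, a => (g v ∈ ks → isFree a (g v) = true) ∧ IsAllowed g ks l (a / 256)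

lemma isFree_eq_true {a k : ℕ} : isFree a k = true ↔ a.testBit k = false := by
  rw [isFree, Nat.beq_eq, show Nat.land a (2 ^ k) = _ from Nat.and_two_pow a k]
  cases a.testBit k <;> simp

lemma isAllowed_zero (g : V → ℕ) (ks : List ℕ) (l : List V) : IsAllowed g ks l 0 := by
  induction l with
  | nil => trivial
  | cons v l ih => exact ⟨fun _ => isFree_eq_true.2 (Nat.zero_testBit _), by rwa [Nat.zero_div]⟩

lemma IsAllowed.or {a b : ℕ} (ha : IsAllowed g ks l a) (hb : IsAllowed g ks l b) :
    IsAllowed g ks l (a ||| b) := by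
  induction l generalizing a b with
  | nil => trivial
  | cons v l ih =>
    refine ⟨fun hv => ?_, ?_⟩
    · rw [isFree_eq_true, Nat.testBit_or, isFree_eq_true.1 (ha.1 hv), isFree_eq_true.1 (hb.1 hv),
        Bool.or_self]
    · rw [show 256 = 2 ^ 8 from rfl, Nat.or_div_two_pow]
      exact ih ha.2 hb.2

lemma isAllowed_blocked (hks : ∀ k ∈ ks, k < 8) {v : V} (hv : g v ∈ ks)
    (h : ∀ u ∈ l, g v = g u → g v < dist v u) :
    IsAllowed g ks l (blocked dist (g v) v l) := by
  induction l with
  | nil => trivial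
  | cons u l ih =>
    obtain ⟨hu, hl⟩ := List.forall_mem_cons.1 h
    set x := bif Nat.ble (dist v u) (g v) then 2 ^ g v else 0 with hx
    have hx_lt : x < 2 ^ 8 := by
      rw [hx, Bool.cond_eq_ite]
      split
      exacts [Nat.pow_lt_pow_right one_lt_two (hks _ hv), by norm_num]
    have blocked_cons : blocked dist (g v) v (u :: l) = 2 ^ 8 * blocked dist (g v) v l + x := rfl
    rw [blocked_cons]
    refine ⟨fun hgu => isFree_eq_true.2 ?_, ?_⟩
    · rw [Nat.testBit_two_pow_mul_add _ hx_lt, if_pos (hks _ hgu), hx]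
      by_cases huv : g v = g u
      · rw [show Nat.ble (dist v u) (g v) = false by
          rw [Bool.eq_false_iff, ne_eq, Nat.ble_eq]; exact (hu huv).not_ge]
        exact Nat.zero_testBit _
      · cases Nat.ble (dist v u) (g v)
        exacts [Nat.zero_testBit _, Nat.testBit_two_pow_of_ne huv]
    · rw [show 256 = 2 ^ 8 from rfl, Nat.mul_add_div (by norm_num),
        Nat.div_eq_of_lt hx_lt, add_zero]
      exact ih hl

lemma IsAllowed.or_blocked (hks : ∀ k ∈ ks, k < 8) {v : V} (hv : g v ∈ ks)
    (hpack : IsPackingOn dist g (v :: l)) {a : ℕ} (ha : IsAllowed g ks (v :: l) a) :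
    IsAllowed g ks l (a / 256 ||| blocked dist (g v) v l) :=
  ha.2.or (isAllowed_blocked hks hv (List.pairwise_cons.1 hpack).1)

theorem minOutside_le_countP (hks : ∀ k ∈ ks, k < 8) (hpack : IsPackingOn dist g l) {a : ℕ}
    (ha : IsAllowed g ks l a) : minOutside dist ks l a ≤ l.countP (g · ∉ ks) := by
  induction l generalizing a with
  | nil => exact le_rfl
  | cons v l ih =>
    have ih := @ih (List.pairwise_cons.1 hpack).2
    rw [minOutside]
    by_cases hv : g v ∈ ks
    · refine (minWhere_le hv (ha.1 hv) _).trans ?_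
      simpa [force_eq, hv] using ih (ha.or_blocked hks hv hpack)
    · refine (minWhere_le_init _ _ _ _).trans ?_
      simpa [force_eq, hv] using ih ha.2

/-- Every choice of colors in `ks` for vertices of `l`, not forbidden by `a` and such that at most
`b` vertices remain, leads to a list of remaining vertices which, added to `r`, passes the test. -/
def checkOutside (dist : V → V → ℕ) (ks : List ℕ) (test : List V → Bool) :
    List V → ℕ → ℕ → List V → Bool
  | [], _, _, r => test r
  | v :: l, a, b, r =>
    Nat.blt b (minOutside dist ks (v :: l) a) ||
      ((Nat.beq b 0 || checkOutside dist ks test l (a / 256) (b - 1) (v :: r)) &&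
        ks.all fun k => !isFree a k ||
          checkOutside dist ks test l (a / 256 ||| blocked dist k v l) b r)

theorem test_of_checkOutside {test : List V → Bool} (hks : ∀ k ∈ ks, k < 8)
    (hpack : IsPackingOn dist g l) {a b : ℕ} (ha : IsAllowed g ks l a)
    (hb : l.countP (g · ∉ ks) ≤ b) {r : List V}
    (h : checkOutside dist ks test l a b r = true) :
    test ((l.filter (g · ∉ ks)).reverse ++ r) = true := by
  induction l generalizing a b r with
  | nil => exact h
  | cons v l ih =>
    have ih := @ih (List.pairwise_cons.1 hpack).2
    have hmin := (minOutside_le_countP hks hpack ha).trans hb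
    simp only [checkOutside, Bool.or_eq_true, Bool.and_eq_true, Nat.blt_eq, hmin.not_gt, false_or,
      Nat.beq_eq, List.all_eq_true, Bool.not_eq_true'] at h
    by_cases hv : g v ∈ ks
    · have := (h.2 _ hv).resolve_left (by simp [ha.1 hv])
      simpa [hv] using ih (ha.or_blocked hks hv hpack) (by simpa [hv] using hb) this
    · rw [List.countP_cons_of_pos (by simpa using hv)] at hb
      have := h.1.resolve_left (by omega)
      simpa [hv] using ih ha.2 (by omega) this

end MinOutside

section Counting

variable {V : Type*} {dist : V → V → ℕ} {g : V → ℕ} {l : List V}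

lemma IsPackingOn.countP_eq_le_card {ι : Type*} [Fintype ι] (hpack : IsPackingOn dist g l)
    (φ : V → ι) {k : ℕ} (h : ∀ u v, φ u = φ v → dist u v ≤ k) :
    l.countP (g · = k) ≤ Fintype.card ι := by
  rw [List.countP_eq_length_filter, ← List.length_map φ]
  refine List.Nodup.length_le_card (List.pairwise_map.2 (List.pairwise_filter.2 ?_))
  refine hpack.imp fun {u v} huv hu hv hφ => ?_
  have hu : g u = k := of_decide_eq_true hu
  have hv : g v = k := of_decide_eq_true hv
  exact (h u v hφ).not_gt (hu ▸ huv (hu.trans hv.symm))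

lemma countP_le_sum {p : V → Bool} {s : Finset ℕ} (h : ∀ v ∈ l, p v = true → g v ∈ s) :
    l.countP p ≤ ∑ k ∈ s, l.countP (g · = k) := by
  induction l with
  | nil => exact Nat.zero_le _
  | cons v l ih =>
    simp only [List.countP_cons, Finset.sum_add_distrib, decide_eq_true_eq]
    refine add_le_add (ih fun u hu => h u (List.mem_cons_of_mem v hu)) ?_
    split_ifs with hp
    · rw [Finset.sum_ite_eq s (g v), if_pos (h v List.mem_cons_self hp)]
    · exact Nat.zero_le _

end Counting

section WordPacking

variable {n c : ℕ}

lemma wordDist_le (n : ℕ) (u v : Word n) : wordDist n u v ≤ 2 ^ n := by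
  induction n with
  | zero => simp only [wordDist]; split <;> simp
  | succ n ih =>
    rw [wordDist, pow_succ]
    split
    · exact (ih _ _).trans (by omega)
    · have := cornerDist_le n (v 0) (Fin.tail u)
      have := cornerDist_le n (u 0) (Fin.tail v)
      omega

lemma IsWordPacking.isPackingOn {f : Word n → ℕ} (hf : IsWordPacking c f) {l : List (Word n)}
    (hl : l.Pairwise (wordDist n · · ≠ 0)) : IsPackingOn (wordDist n) f l :=
  hl.imp fun hne h => hf.lt_wordDist h hne

lemma IsWordPacking.countP_eq_le_one {f : Word n → ℕ} (hf : IsWordPacking c f)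
    {l : List (Word n)} (hl : l.Pairwise (wordDist n · · ≠ 0)) {k : ℕ} (hk : 2 ^ n ≤ k) :
    l.countP (f · = k) ≤ 1 :=
  (hf.isPackingOn hl).countP_eq_le_card (fun _ => ()) fun u v _ => (wordDist_le n u v).trans hk

lemma IsWordPacking.countP_eq_le_three {f : Word (n + 1) → ℕ} (hf : IsWordPacking c f)
    {l : List (Word (n + 1))} (hl : l.Pairwise (wordDist (n + 1) · · ≠ 0)) {k : ℕ}
    (hk : 2 ^ n ≤ k) : l.countP (f · = k) ≤ 3 :=
  (hf.isPackingOn hl).countP_eq_le_card (fun u => u 0) fun u v h => by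
    rw [wordDist, if_pos h]
    exact (wordDist_le n _ _).trans hk

lemma succ_le_packingChromaticNumber_iff :
    ((c + 1 : ℕ) : ℕ∞) ≤ packingChromaticNumber (sierpinskiTriangleGraph n) ↔
      ∀ f : Word n → ℕ, ¬ IsWordPacking c f := by
  rw [← not_exists, ← packingChromaticNumber_le_iff_exists_isWordPacking, not_le, Nat.cast_succ,
    ENat.add_one_le_iff (ENat.natCast_ne_top c)]

/-- Each color from `2 ^ n` on occurs at most once. -/
theorem succ_le_packingChromaticNumber_of_minOutside {l : List (Word n)} (hn : n ≤ 3)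
    (hl : l.Pairwise (wordDist n · · ≠ 0))
    (h : c + 1 - 2 ^ n < minOutside (wordDist n) (List.range' 1 (2 ^ n - 1)) l 0) :
    ((c + 1 : ℕ) : ℕ∞) ≤ packingChromaticNumber (sierpinskiTriangleGraph n) := by
  refine succ_le_packingChromaticNumber_iff.2 fun f hf => h.not_ge ?_
  set ks := List.range' 1 (2 ^ n - 1) with hks
  have hpow : 2 ^ n ≤ 8 := Nat.pow_le_pow_right two_pos hn
  have hmin : minOutside (wordDist n) ks l 0 ≤ l.countP (f · ∉ ks) :=
    minOutside_le_countP (fun k hk => by rw [hks, List.mem_range'_1] at hk; omega)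
      (hf.isPackingOn hl) (isAllowed_zero f ks l)
  have hsum : l.countP (f · ∉ ks) ≤ ∑ k ∈ Finset.Icc (2 ^ n) c, l.countP (f · = k) :=
    countP_le_sum fun u _ hu => by
      have := hf.mem_Icc u
      simp only [hks, List.mem_range'_1, decide_eq_true_eq, Set.mem_Icc] at hu this
      exact Finset.mem_Icc.2 (by omega)
  have hcard : ∑ k ∈ Finset.Icc (2 ^ n) c, l.countP (f · = k) ≤ c + 1 - 2 ^ n := by
    refine (Finset.sum_le_card_nsmul _ _ 1 fun k hk =>
      hf.countP_eq_le_one hl (Finset.mem_Icc.1 hk).1).trans_eq ?_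
    rw [Nat.card_Icc, smul_eq_mul, mul_one]
  omega

lemma third_apply : ∀ (σ : Equiv.Perm (Fin 3)) {a b : Fin 3}, a ≠ b →
    third (σ a) (σ b) = σ (third a b) := by decide

lemma cornerDist_comp (σ : Equiv.Perm (Fin 3)) (n : ℕ) (j : Fin 3) (u : Word n) :
    cornerDist n (σ j) (σ ∘ u) = cornerDist n j u := by
  induction n with
  | zero => simp only [cornerDist, Function.comp_apply, σ.injective.eq_iff]
  | succ n ih =>
    simp only [cornerDist, Function.comp_apply, σ.injective.eq_iff]
    exact congrArg _ (ih (Fin.tail u))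

lemma wordDist_comp (σ : Equiv.Perm (Fin 3)) (n : ℕ) (u v : Word n) :
    wordDist n (σ ∘ u) (σ ∘ v) = wordDist n u v := by
  induction n with
  | zero => simp only [wordDist, Function.comp_apply, σ.injective.eq_iff]
  | succ n ih =>
    have tail_comp (w : Word (n + 1)) : Fin.tail (σ ∘ w) = σ ∘ Fin.tail w := rfl
    simp only [wordDist, Function.comp_apply, σ.injective.eq_iff, tail_comp]
    by_cases h : u 0 = v 0
    · rw [if_pos h, if_pos h, ih]
    · simp only [if_neg h, third_apply σ h, cornerDist_comp]

lemma IsWordPacking.comp {f : Word n → ℕ} (hf : IsWordPacking c f) (σ : Equiv.Perm (Fin 3)) :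
    IsWordPacking c fun u => f (σ ∘ u) where
  mem_Icc _ := hf.mem_Icc _
  eq_of_wordDist_eq_zero h := hf.eq_of_wordDist_eq_zero (by rwa [wordDist_comp])
  lt_wordDist {u v} h := by
    rw [← wordDist_comp σ n u v]
    exact hf.lt_wordDist h

lemma IsWordPacking.restrict {f : Word (n + 1) → ℕ} (hf : IsWordPacking c f) (i : Fin 3) :
    IsWordPacking c fun u => f (cons i u) := by
  have wordDist_cons (u v : Word n) : wordDist (n + 1) (cons i u) (cons i v) = wordDist n u v := by
    simp [wordDist]
  exact
    { mem_Icc := fun _ => hf.mem_Icc _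
      eq_of_wordDist_eq_zero := fun h => hf.eq_of_wordDist_eq_zero (by rwa [wordDist_cons])
      lt_wordDist := fun {u v} h => by
        rw [← wordDist_cons]
        exact hf.lt_wordDist h }

theorem packingChromaticNumber_monotone :
    Monotone fun n => packingChromaticNumber (sierpinskiTriangleGraph n) := by
  refine monotone_nat_of_le_succ fun n => ENat.forall_natCast_le_iff_le.1 fun c hc => ?_
  cases c with
  | zero => exact zero_le
  | succ c =>
    rw [succ_le_packingChromaticNumber_iff] at hc ⊢
    exact fun f hf => hc _ (hf.restrict 0)

end WordPacking

/-- The word of length `n + 1` whose letters are the digits of `c` in base 3. -/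
def word (n c : ℕ) : Word n := fun k => Fin.ofNat 3 (c / 3 ^ (n - k.val))

/-- The numbers coding, by `word 3`, one word for each vertex of `ST_3^3`. The first 3, 6, 15 of
them code, by `word 0`, `word 1`, `word 2`, one word for each vertex of `ST_3^0`, `ST_3^1`,
`ST_3^2`. -/
def codes : List ℕ :=
  [0, 1, 2, 4, 5, 8, 10, 11, 13, 14, 17, 19, 20, 23, 26, 28, 29, 31, 32, 35, 37, 38, 40, 41, 44, 46,
    47, 50, 53, 55, 56, 58, 59, 62, 64, 65, 68, 71, 73, 74, 77, 80]

theorem three_le_packingChromaticNumber_zero :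
    3 ≤ packingChromaticNumber (sierpinskiTriangleGraph 0) :=
  succ_le_packingChromaticNumber_of_minOutside (c := 2) (l := (codes.take 3).map (word 0))
    (by decide) (by decide +kernel) (by decide +kernel)

theorem four_le_packingChromaticNumber_one :
    4 ≤ packingChromaticNumber (sierpinskiTriangleGraph 1) :=
  succ_le_packingChromaticNumber_of_minOutside (c := 3) (l := (codes.take 6).map (word 1))
    (by decide) (by decide +kernel) (by decide +kernel)

theorem eight_le_packingChromaticNumber_two :
    8 ≤ packingChromaticNumber (sierpinskiTriangleGraph 2) :=
  succ_le_packingChromaticNumber_of_minOutside (c := 7) (l := (codes.take 15).map (word 2))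
    (by decide) (by decide +kernel) (by decide +kernel)

lemma pairwise_map_codes : (codes.map (word 3)).Pairwise (wordDist 3 · · ≠ 0) := by decide +kernel

section Eleven

variable {m : ℕ} {f : Word 3 → ℕ} {l : List (Word 3)}

/-- In every packing coloring of the list, at least 11 vertices have a color outside `{6, 7}`, or at
least 8 vertices have a color outside `{5, 6, 7}`. With the colors `4, …, 11` this is impossible, as
4 and 5 occur at most 3 times and the colors from 8 on at most once. -/
def isOverfull (l : List (Word 3)) : Bool :=
  Nat.blt 10 (minOutside (wordDist 3) [6, 7] l 0) ||
    Nat.blt 7 (minOutside (wordDist 3) [5, 6, 7] l 0)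

lemma IsWordPacking.countP_le_sum_ite (hf : IsWordPacking m f)
    (hl : l.Pairwise (wordDist 3 · · ≠ 0)) {p : Word 3 → Bool} {s : Finset ℕ}
    (h : ∀ u ∈ l, p u = true → f u ∈ s) (hs : ∀ k ∈ s, 4 ≤ k) :
    l.countP p ≤ ∑ k ∈ s, if k < 8 then 3 else 1 := by
  refine (countP_le_sum h).trans (Finset.sum_le_sum fun k hk => ?_)
  split_ifs with hk8
  · exact hf.countP_eq_le_three hl (hs k hk)
  · exact hf.countP_eq_le_one hl (not_lt.1 hk8)

lemma IsWordPacking.isOverfull_eq_false (hf : IsWordPacking 11 f)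
    (hl : l.Pairwise (wordDist 3 · · ≠ 0)) (h4 : ∀ u ∈ l, 4 ≤ f u) : isOverfull l = false := by
  have minOutside_le {ks : List ℕ} (hks : ∀ k ∈ ks, k < 8) :
      minOutside (wordDist 3) ks l 0 ≤
        ∑ k ∈ (Finset.Icc 4 11).filter (· ∉ ks), if k < 8 then 3 else 1 := by
    refine (minOutside_le_countP hks (hf.isPackingOn hl) (isAllowed_zero _ _ _)).trans
      (hf.countP_le_sum_ite hl (fun u hu hfu => ?_) fun k hk => ?_)
    · exact Finset.mem_filter.2
        ⟨Finset.mem_Icc.2 ⟨h4 u hu, (hf.mem_Icc u).2⟩, of_decide_eq_true hfu⟩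
    · exact (Finset.mem_Icc.1 (Finset.mem_filter.1 hk).1).1
  have h67 : minOutside (wordDist 3) [6, 7] l 0 ≤ 10 := minOutside_le (by decide)
  have h567 : minOutside (wordDist 3) [5, 6, 7] l 0 ≤ 7 := minOutside_le (by decide)
  rw [← Bool.not_eq_true, isOverfull, Bool.or_eq_true, Nat.blt_eq, Nat.blt_eq]
  omega

/-- The number of vertices with a color outside `{1, 2, 3}`. -/
def numLarge (f : Word 3 → ℕ) : ℕ := (codes.map (word 3)).countP (f · ∉ [1, 2, 3])

/-- The number of vertices of color `k`. -/
def numColor (f : Word 3 → ℕ) (k : ℕ) : ℕ := (codes.map (word 3)).countP (f · = k)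

lemma IsWordPacking.numColor_le_three (hf : IsWordPacking m f) {k : ℕ} (hk : 4 ≤ k) :
    numColor f k ≤ 3 :=
  hf.countP_eq_le_three pairwise_map_codes hk

lemma IsWordPacking.numLarge_le (hf : IsWordPacking 11 f) :
    numLarge f ≤ 10 + numColor f 6 + numColor f 7 := by
  have hsum : numLarge f ≤ ∑ k ∈ Finset.Icc 4 11, numColor f k :=
    countP_le_sum fun u _ hu => by
      have := hf.mem_Icc u
      simp only [List.mem_cons, List.not_mem_nil, or_false, decide_eq_true_eq, Set.mem_Icc]
        at hu this
      exact Finset.mem_Icc.2 (by omega)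
  have le_one {k : ℕ} (hk : 8 ≤ k) : numColor f k ≤ 1 := hf.countP_eq_le_one pairwise_map_codes hk
  have := hf.numColor_le_three (k := 4) (by norm_num)
  have := hf.numColor_le_three (k := 5) (by norm_num)
  have := le_one (k := 8) (by norm_num)
  have := le_one (k := 9) (by norm_num)
  have := le_one (k := 10) (by norm_num)
  have := le_one (k := 11) (by norm_num)
  rw [show Finset.Icc 4 11 = {4, 5, 6, 7, 8, 9, 10, 11} by decide] at hsum
  simp only [Finset.mem_insert, Nat.reduceEqDiff, Finset.mem_singleton, or_self, not_false_eq_true,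
    Finset.sum_insert, Finset.sum_singleton] at hsum
  omega

lemma numLarge_eq {s : List ℕ} (hs : (s ++ codes.diff s).Perm codes)
    (h4 : ∀ c ∈ s, 4 ≤ f (word 3 c)) :
    numLarge f = s.length + ((codes.diff s).map (word 3)).countP (f · ∉ [1, 2, 3]) := by
  rw [numLarge, ← (hs.map (word 3)).countP_eq, List.map_append, List.countP_append,
    List.countP_eq_length.2 fun u hu => ?_, List.length_map]
  obtain ⟨c, hc, rfl⟩ := List.mem_map.1 hu
  have := h4 c hc
  simp only [List.mem_cons, List.not_mem_nil, or_false, decide_eq_true_eq]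
  omega

lemma pairwise_map_diff {s : List ℕ} (hs : (s ++ codes.diff s).Perm codes) :
    (s.map (word 3) ++ (codes.diff s).map (word 3)).Pairwise (wordDist 3 · · ≠ 0) := by
  rw [← List.map_append]
  exact (hs.map (word 3)).symm.pairwise pairwise_map_codes fun h => by rwa [wordDist_comm]

lemma IsWordPacking.add_minOutside_le_numLarge (hf : IsWordPacking m f) {s : List ℕ}
    (hs : (s ++ codes.diff s).Perm codes) (h4 : ∀ c ∈ s, 4 ≤ f (word 3 c)) :
    s.length + minOutside (wordDist 3) [1, 2, 3] ((codes.diff s).map (word 3)) 0 ≤ numLarge f := by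
  rw [numLarge_eq hs h4]
  exact Nat.add_le_add_left (minOutside_le_countP (by decide)
    (hf.isPackingOn (List.pairwise_append.1 (pairwise_map_diff hs)).2.1) (isAllowed_zero _ _ _)) _

lemma IsWordPacking.lt_numLarge (hf : IsWordPacking 11 f) {s : List ℕ} {b : ℕ}
    (hs : (s ++ codes.diff s).Perm codes) (h4 : ∀ c ∈ s, 4 ≤ f (word 3 c))
    (h : checkOutside (wordDist 3) [1, 2, 3] isOverfull ((codes.diff s).map (word 3)) 0 b
      (s.map (word 3)) = true) : s.length + b < numLarge f := by
  by_contra! hb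
  rw [numLarge_eq hs h4, Nat.add_le_add_iff_left] at hb
  have hpairwise := pairwise_map_diff hs
  have htest := test_of_checkOutside (by decide)
    (hf.isPackingOn (List.pairwise_append.1 hpairwise).2.1) (isAllowed_zero _ _ _) hb h
  refine Bool.false_ne_true ((hf.isOverfull_eq_false ?_ fun u hu => ?_).symm.trans htest)
  · have hsublist := (List.Sublist.refl (s.map (word 3))).append
      (List.filter_sublist (l := (codes.diff s).map (word 3)) (p := (f · ∉ [1, 2, 3])))
    exact (List.perm_append_comm.trans ((List.reverse_perm _).symm.append_right _)).pairwise
      (hpairwise.sublist hsublist) fun h => by rwa [wordDist_comm]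
  · rcases List.mem_append.1 hu with hu | hu
    · have := (hf.mem_Icc u).1
      have := (List.mem_filter.1 (List.mem_reverse.1 hu)).2
      simp only [List.mem_cons, List.not_mem_nil, or_false, decide_eq_true_eq] at this
      omega
    · obtain ⟨c, hc, rfl⟩ := List.mem_map.1 hu
      exact h4 c hc

lemma IsWordPacking.exists_forall_eq (hf : IsWordPacking m f) {k : ℕ} (hk : 2 < numColor f k)
    {ts : List (List ℕ)}
    (hts : ∀ a ∈ codes, ∀ b ∈ codes, k < wordDist 3 (word 3 a) (word 3 b) → ∀ c ∈ codes,
      k < wordDist 3 (word 3 a) (word 3 c) → k < wordDist 3 (word 3 b) (word 3 c) →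
        ∃ t ∈ ts, t ⊆ [a, b, c]) : ∃ t ∈ ts, ∀ c ∈ t, f (word 3 c) = k := by
  rw [numColor, List.countP_map, List.countP_eq_length_filter] at hk
  obtain ⟨a, b, c, l, hl⟩ : ∃ a b c l, codes.filter ((f · = k) ∘ word 3) = a :: b :: c :: l := by
    match codes.filter ((f · = k) ∘ word 3), hk with
    | a :: b :: c :: l, _ => exact ⟨a, b, c, l, rfl⟩
  have hsublist : [a, b, c].Sublist (codes.filter ((f · = k) ∘ word 3)) := by
    rw [hl]
    exact List.sublist_append_left [a, b, c] l
  have hmem {x : ℕ} (hx : x ∈ [a, b, c]) : x ∈ codes ∧ f (word 3 x) = k := by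
    simpa using List.mem_filter.1 (hsublist.subset hx)
  have hpairwise : [a, b, c].Pairwise fun x y => k < wordDist 3 (word 3 x) (word 3 y) :=
    ((List.pairwise_map.1 (hf.isPackingOn pairwise_map_codes)).sublist
      (hsublist.trans List.filter_sublist)).imp_of_mem fun hx hy h => by
        rw [(hmem hx).2, (hmem hy).2] at h
        exact h rfl
  simp only [List.pairwise_cons, List.mem_cons, List.not_mem_nil, or_false, forall_eq_or_imp,
    forall_eq] at hpairwise
  obtain ⟨t, ht, htabc⟩ := hts a (hmem (by simp)).1 b (hmem (by simp)).1 hpairwise.1.1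
    c (hmem (by simp)).1 hpairwise.1.2 hpairwise.2.1
  exact ⟨t, ht, fun x hx => (hmem (htabc hx)).2⟩

lemma corner_eq_word : ∀ j : Fin 3, corner 3 j = word 3 (40 * j) := by decide

lemma fourteen_le_minOutside :
    14 ≤ minOutside (wordDist 3) [1, 2, 3] ((codes.diff [0, 40, 80]).map (word 3)) 0 := by
  decide +kernel

lemma checkOutside_corner :
    checkOutside (wordDist 3) [1, 2, 3] isOverfull ((codes.diff [40]).map (word 3)) 0 14
      ([40].map (word 3)) = true := by
  decide +kernel

lemma checkOutside_triple :
    checkOutside (wordDist 3) [1, 2, 3] isOverfull ((codes.diff [2, 37, 77]).map (word 3)) 0 12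
      ([2, 37, 77].map (word 3)) = true := by
  decide +kernel

lemma checkOutside_nil :
    checkOutside (wordDist 3) [1, 2, 3] isOverfull ((codes.diff []).map (word 3)) 0 14
      ([].map (word 3)) = true := by
  decide +kernel

lemma IsWordPacking.exists_corner_ne_seven (hf : IsWordPacking 11 f) :
    ∃ j, f (corner 3 j) ≠ 7 := by
  by_contra! h
  have h7 : ∀ c ∈ [0, 40, 80], f (word 3 c) = 7 := by
    simpa [corner_eq_word, Fin.forall_fin_succ] using h
  have hlarge := hf.add_minOutside_le_numLarge (s := [0, 40, 80]) (by decide)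
    fun c hc => (h7 c hc).symm ▸ by norm_num
  rw [List.length_cons, List.length_cons, List.length_singleton] at hlarge
  have := fourteen_le_minOutside
  have := hf.numLarge_le
  have := hf.numColor_le_three (k := 6) (by norm_num)
  have := hf.numColor_le_three (k := 7) (by norm_num)
  omega

lemma IsWordPacking.numColor_seven_le (hf : IsWordPacking 11 f) : numColor f 7 ≤ 2 := by
  by_contra! h
  obtain ⟨j, hj⟩ := hf.exists_corner_ne_seven
  have h7 : ∃ t ∈ [[0, 40, 80]], ∀ c ∈ t, f (word 3 c) = 7 :=
    hf.exists_forall_eq h (by decide +kernel)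
  refine hj ?_
  rw [corner_eq_word]
  fin_cases j <;> simp_all

lemma IsWordPacking.corner_ne_six (hf : IsWordPacking 11 f) (j : Fin 3) : f (corner 3 j) ≠ 6 := by
  have corner_one_ne_six {g : Word 3 → ℕ} (hg : IsWordPacking 11 g) : g (word 3 40) ≠ 6 := by
    intro h
    have hlarge : 1 + 14 < numLarge g :=
      hg.lt_numLarge (by decide) (by simp [h]) checkOutside_corner
    have := hg.numLarge_le
    have := hg.numColor_le_three (k := 6) (by norm_num)
    have := hg.numColor_seven_le
    omega
  have swap_comp : Equiv.swap 1 j ∘ word 3 40 = corner 3 j := by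
    rw [show word 3 40 = corner 3 1 from (corner_eq_word 1).symm]
    exact funext fun _ => Equiv.swap_apply_left 1 j
  exact swap_comp ▸ corner_one_ne_six (hf.comp (Equiv.swap 1 j))

lemma IsWordPacking.not_forall_eq_six (hf : IsWordPacking 11 f) :
    ¬ ∀ c ∈ [2, 37, 77], f (word 3 c) = 6 := by
  intro h
  have hlarge : 3 + 12 < numLarge f :=
    hf.lt_numLarge (by decide) (fun c hc => (h c hc).symm ▸ by norm_num) checkOutside_triple
  have := hf.numLarge_le
  have := hf.numColor_le_three (k := 6) (by norm_num)
  have := hf.numColor_seven_le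
  omega

lemma IsWordPacking.not_forall_eq_six_mirror (hf : IsWordPacking 11 f) :
    ¬ ∀ c ∈ [1, 41, 74], f (word 3 c) = 6 := by
  simp only [List.forall_mem_cons]
  rintro ⟨h1, h41, h74, -⟩
  refine (hf.comp (Equiv.swap 1 2)).not_forall_eq_six ?_
  simp only [List.forall_mem_cons]
  have swap_two : Equiv.swap 1 2 ∘ word 3 2 = word 3 1 := by decide
  have swap_37 : Equiv.swap 1 2 ∘ word 3 37 = word 3 74 := by decide
  have swap_77 : wordDist 3 (Equiv.swap 1 2 ∘ word 3 77) (word 3 41) = 0 := by decide +kernel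
  rw [swap_two, swap_37, hf.eq_of_wordDist_eq_zero swap_77]
  exact ⟨h1, h74, h41, List.forall_mem_nil _⟩

lemma IsWordPacking.numColor_six_le (hf : IsWordPacking 11 f) : numColor f 6 ≤ 2 := by
  by_contra! h
  have h6 : ∃ t ∈ [[0], [40], [80], [2, 37, 77], [1, 41, 74]], ∀ c ∈ t, f (word 3 c) = 6 :=
    hf.exists_forall_eq h (by decide +kernel)
  have corner_ne_six (j : Fin 3) : f (word 3 (40 * j)) ≠ 6 := corner_eq_word j ▸ hf.corner_ne_six j
  simp only [List.exists_mem_cons_iff, List.forall_mem_singleton] at h6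
  rcases h6 with h | h | h | h | h | ⟨_, h, _⟩
  · exact corner_ne_six 0 h
  · exact corner_ne_six 1 h
  · exact corner_ne_six 2 h
  · exact hf.not_forall_eq_six h
  · exact hf.not_forall_eq_six_mirror h
  · exact List.not_mem_nil h

theorem not_isWordPacking_eleven (f : Word 3 → ℕ) : ¬ IsWordPacking 11 f := by
  intro hf
  have hlarge : 0 + 14 < numLarge f := hf.lt_numLarge (by decide) (by simp) checkOutside_nil
  have := hf.numLarge_le
  have := hf.numColor_six_le
  have := hf.numColor_seven_le
  omega

end Eleven

theorem twelve_le_packingChromaticNumber {n : ℕ} (hn : 3 ≤ n) :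
    12 ≤ packingChromaticNumber (sierpinskiTriangleGraph n) :=
  (succ_le_packingChromaticNumber_iff.2 not_isWordPacking_eleven).trans
    (packingChromaticNumber_monotone hn)

end SierpinskiPacking

theorem mainTheorem1 :
    (SierpinskiPacking.packingChromaticNumber (SierpinskiPacking.sierpinskiTriangleGraph 0) = 3 ∧
      SierpinskiPacking.packingChromaticNumber (SierpinskiPacking.sierpinskiTriangleGraph 1) = 4 ∧
      SierpinskiPacking.packingChromaticNumber (SierpinskiPacking.sierpinskiTriangleGraph 2) = 8 ∧
      SierpinskiPacking.packingChromaticNumber (SierpinskiPacking.sierpinskiTriangleGraph 3) = 12) ∧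
    (12 ≤ SierpinskiPacking.packingChromaticNumber (SierpinskiPacking.sierpinskiTriangleGraph 4) ∧
      SierpinskiPacking.packingChromaticNumber (SierpinskiPacking.sierpinskiTriangleGraph 4) ≤ 15) ∧
    (12 ≤ SierpinskiPacking.packingChromaticNumber (SierpinskiPacking.sierpinskiTriangleGraph 5) ∧
      SierpinskiPacking.packingChromaticNumber (SierpinskiPacking.sierpinskiTriangleGraph 5) ≤ 19) ∧
    (∀ n : ℕ, 6 ≤ n →
      12 ≤ SierpinskiPacking.packingChromaticNumber
          (SierpinskiPacking.sierpinskiTriangleGraph n) ∧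
        SierpinskiPacking.packingChromaticNumber
          (SierpinskiPacking.sierpinskiTriangleGraph n) ≤ 20) := by
  have lower {n : ℕ} (hn : 3 ≤ n) := SierpinskiPacking.twelve_le_packingChromaticNumber hn
  refine ⟨⟨le_antisymm ?_ ?_, le_antisymm ?_ ?_, le_antisymm ?_ ?_, le_antisymm ?_ ?_⟩,
    ⟨lower (by norm_num), ?_⟩, ⟨lower (by norm_num), ?_⟩, fun n hn => ⟨lower (by omega), ?_⟩⟩
  · exact SierpinskiPacking.packingChromaticNumber_zero_le
  · exact SierpinskiPacking.three_le_packingChromaticNumber_zero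
  · exact SierpinskiPacking.packingChromaticNumber_one_le
  · exact SierpinskiPacking.four_le_packingChromaticNumber_one
  · exact SierpinskiPacking.packingChromaticNumber_two_le
  · exact SierpinskiPacking.eight_le_packingChromaticNumber_two
  · exact SierpinskiPacking.packingChromaticNumber_three_le
  · exact lower le_rfl
  · exact SierpinskiPacking.packingChromaticNumber_four_le
  · exact SierpinskiPacking.packingChromaticNumber_five_le
  · obtain ⟨k, rfl⟩ := Nat.exists_eq_add_of_le hn
    exact SierpinskiPacking.packingChromaticNumber_six_add_le k
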